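/- For $\tau\in\mathbb H$, $z\in\mathbb C$ put $q=e^{2\pi i\tau}$, $\zeta=e^{2\pi i z}$ (with $q^r=e^{2\pi i r\tau}$, $\zeta^r=e^{2\pi i rz}$), and let all square roots be principal. Let $$T(z;\tau)=2i\sum_{n\ge0}(-1)^n\zeta^{n+\frac12}q^{\frac12(n+\frac12)^2},\qquad \vartheta(z;\tau)=i\sum_{n\in\mathbb Z}(-1)^n\zeta^{n+\frac12}q^{\frac12(n+\frac12)^2},$$ and, for $\tau$ with $T(0;\tau)\neq0$, define $g_k(\tau)$ $(k\ge1)$ by $$T(z;\tau)=T(0;\tau)\exp\Bigl(-\sum_{k\ge1}g_k(\tau)\frac{(2\pi i z)^k}{k!}\Bigr)\quad\text{for } z \text{ near } 0.$$ For $\tau,w\in\mathbb H$ let, with $\operatorname{erf}(x)=\frac2{\sqrt\pi}\int_0^xe^{-t^2}dt$, $$\widehat T(z;\tau,w)=\vartheta(z;\tau)+i\sum_{n\in\mathbb Z}\operatorname{erf}\Bigl(-i\sqrt{\pi i(w-\tau)}\bigl(n+\tfrac12+\tfrac{\operatorname{Im} z}{\operatorname{Im}\tau}\bigr)\Bigr)(-1)^n\zeta^{n+\frac12}q^{\frac12(n+\frac12)^2}.$$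 For $\tau\ne w$ and $\gamma=\begin{pmatrix}a&b\\c&d\end{pmatrix}\in\mathrm{SL}_2(\mathbb Z)$ let $$\chi_{\tau,w}(\gamma)=\sqrt{\frac{i(w-\tau)}{(c\tau+d)(cw+d)}}\;\frac{\sqrt{c\tau+d}\,\sqrt{cw+d}}{\sqrt{i(w-\tau)}}\in\{1,-1\}.$$ Theorem. There exist functions $\widehat g_k:\mathbb H\times\mathbb H\to\mathbb C$ $(k\ge1)$ such that at every $(\tau,w)$ with $\widehat T(0;\tau,w)\neq0$ the number $\widehat g_k(\tau,w)$ is the coefficient of $-\frac{(2\pi i z)^k}{k!}$ in the Taylor expansion in $z$ and $\overline z$ at $z=0$ of the real-analytic function $\operatorname{Log}\bigl(\widehat T(z;\tau,w)/\widehat T(0;\tau,w)\bigr)$, and such that the following hold for all $k\ge1$. 1. For all $\tau,w\in\mathbb H$ with $\tau\ne w$ and all $\gamma=\begin{pmatrix}a&b\\c&d\end{pmatrix}\in\mathrm{SL}_2(\mathbb Z)$, $$\widehat g_k\Bigl(\frac{a\tau+b}{c\tau+d},\frac{aw+b}{cw+d}\Bigr)=\chi_{\tau,w}(\gamma)^k(c\tau+d)^k\,\widehat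 g_k(\tau,w)+\delta_{k,2}\frac{ic}{2\pi}(c\tau+d).$$ 2. For all $\tau\in\mathbb H$ with $T(0;\tau)\ne0$ and all $\varepsilon>0$, $$\lim_{t\to\infty}\widehat g_k(\tau,\tau+it+\varepsilon)=g_k(\tau).$$ -/

import Mathlib

open scoped UpperHalfPlane MatrixGroups Topology
open Filter

noncomputable section

namespace PartialTheta

/-- The complex error function `erf z = (2 / √π) ∫_0^z exp (-t²) dt`, the integral being taken
along the segment `t = s z`, `0 ≤ s ≤ 1`. -/
def erf (z : ℂ) : ℂ :=
  2 / (Real.sqrt Real.pi : ℂ) * (z * ∫ s in (0 : ℝ)..1, Complex.exp (-((s : ℂ) * z) ^ 2))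

/-- The term `(-1)^n ζ^(n+1/2) q^((n+1/2)²/2)` with `ζ = exp (2πiz)` and `q = exp (2πiτ)`. -/
def thetaTerm (n : ℤ) (z : ℂ) (τ : ℍ) : ℂ :=
  (-1 : ℂ) ^ n * Complex.exp (2 * Real.pi * Complex.I * ((n : ℂ) + 1 / 2) * z) *
    Complex.exp (Real.pi * Complex.I * ((n : ℂ) + 1 / 2) ^ 2 * (τ : ℂ))

/-- The Jacobi theta function `ϑ(z;τ)`. -/
def jacobiTheta (z : ℂ) (τ : ℍ) : ℂ :=
  Complex.I * ∑' n : ℤ, thetaTerm n z τ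

/-- The partial theta function `T(z;τ)`. -/
def T (z : ℂ) (τ : ℍ) : ℂ :=
  2 * Complex.I * ∑' n : ℕ, thetaTerm n z τ

/-- The partial Eisenstein series `g_k(τ)`, defined by the expansion
`T(z;τ) = T(0;τ) exp (-∑_{k ≥ 1} g_k(τ) (2πiz)^k / k!)` near `z = 0`, where `T(0;τ) ≠ 0`;
that is, `-g_k(τ) (2πi)^k` is the `k`-th derivative of `Log (T(z;τ) / T(0;τ))` at `z = 0`. -/
def g (k : ℕ) (τ : ℍ) : ℂ :=
  -iteratedDeriv k (fun z : ℂ => Complex.log (T z τ / T 0 τ)) 0 /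
    (2 * Real.pi * Complex.I) ^ k

/-- The completion `ψ̂(z;τ,w)` of the false theta function
`i ∑_{n ∈ ℤ} sgn(n+1/2) (-1)^n ζ^(n+1/2) q^((n+1/2)²/2)`. The square root is principal. -/
def psiHat (z : ℂ) (τ w : ℍ) : ℂ :=
  Complex.I * ∑' n : ℤ,
    erf (-Complex.I * Complex.sqrt (Real.pi * Complex.I * ((w : ℂ) - (τ : ℂ))) *
      ((n : ℂ) + 1 / 2 + ((z.im / τ.im : ℝ) : ℂ))) * thetaTerm n z τ

/-- The completion `T̂ = ϑ + ψ̂` of the partial theta function `T`. -/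
def THat (z : ℂ) (τ w : ℍ) : ℂ :=
  jacobiTheta z τ + psiHat z τ w

/-- The Wirtinger derivative `∂f/∂z = (∂f/∂x - i ∂f/∂y) / 2`. -/
def wirtinger (f : ℂ → ℂ) (z : ℂ) : ℂ :=
  (fderiv ℝ f z 1 - Complex.I * fderiv ℝ f z Complex.I) / 2

/-- The coefficient of `-(2πiz)^k / k!` in the Taylor expansion in `z` and `z̄` at `0` of the
real-analytic function `Log (T̂(z;τ,w) / T̂(0;τ,w))`. It is meaningful where `T̂(0;τ,w) ≠ 0`. -/
def gHatCoeff (k : ℕ) (τ w : ℍ) : ℂ :=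
  -wirtinger^[k] (fun z : ℂ => Complex.log (THat z τ w / THat 0 τ w)) 0 /
    (2 * Real.pi * Complex.I) ^ k

/-- The automorphy factor `cτ + d` of `γ = (a b; c d)`. -/
def cocycle (γ : SL(2, ℤ)) (τ : ℍ) : ℂ :=
  ((γ 1 0 : ℤ) : ℂ) * (τ : ℂ) + ((γ 1 1 : ℤ) : ℂ)

/-- The multiplier `χ_{τ,w}(γ)`, for `τ ≠ w`, with principal square roots. -/
def chi (γ : SL(2, ℤ)) (τ w : ℍ) : ℂ :=
  Complex.sqrt (Complex.I * ((w : ℂ) - (τ : ℂ)) / (cocycle γ τ * cocycle γ w)) *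
    (Complex.sqrt (cocycle γ τ) * Complex.sqrt (cocycle γ w) /
      Complex.sqrt (Complex.I * ((w : ℂ) - (τ : ℂ))))

end PartialTheta

end

noncomputable section

namespace PartialTheta

/-! Write `erf x = (2/√π) x M(x²)` with `M` entire. The square root in `psiHat` then leaves the sum:
ψ̂ is a multiple of √(πi(w-τ)) times a series `errSum` that is holomorphic in `w`, also at w = τ.
The equation 2vM' + M = exp(-v), applied term by term, gives 2(w-τ)∂E/∂w + E = Θ for E = `errSum`,
with Θ a theta series of weight 3/2 in `w` (`errSum_ode`). The inversion law of Θ comes from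
Jacobi's theta function (`thetaDeriv_inversion`). A solution holomorphic at w = τ is unique
(`eq_zero_of_ode`), so E inherits an inversion law (`errSum_inversion`). The matrices S and T then
give all of SL₂(ℤ) (`isModularAt`).

Comparing the square roots leaves only the sign χ: up to a common nonzero factor, ϑ + ψ̂ goes to ϑ +
χψ̂. As ϑ is odd and ψ̂ even in z, this equals χT̂(χz) (`THat_smul`). After taking logarithms, the
factor exp(πicz²/(cτ+d)) affects only k = 2, while the rescaling of z produces χ^k(cτ+d)^k
(`gHatCoeff_smul`).

T̂ is not holomorphic in z, but it is F(z, z̄) with F entire on ℂ². Its pure z-derivatives at 0 are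
therefore those of the holomorphic slice s ↦ F(s, 0) (`wirtinger_iterate_comp_conj`). On this slice
T̂ - T is O(exp(-πt/8)) uniformly near s = 0 (`exists_norm_THatPolar_sub_T_le`), and locally uniform
convergence passes to logarithmic derivatives; this gives the limit. -/

/-! ### Parametric integrals and separately entire functions of two variables -/

theorem hasDerivAt_intervalIntegral_of_continuous {F F' : ℂ → ℝ → ℂ} (a b : ℝ)
    (hF : Continuous F.uncurry) (hF' : Continuous F'.uncurry)
    (h : ∀ x t, HasDerivAt (fun y => F y t) (F' x t) x) (x : ℂ) :
    HasDerivAt (fun y => ∫ t in a..b, F y t) (∫ t in a..b, F' x t) x := by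
  obtain ⟨C, hC⟩ := ((isCompact_closedBall x 1).prod (isCompact_uIcc (a := a) (b := b))).exists_bound_of_continuousOn
    hF'.continuousOn
  refine (intervalIntegral.hasDerivAt_integral_of_dominated_loc_of_deriv_le (μ := MeasureTheory.volume)
    (bound := fun _ => C)
    (Metric.closedBall_mem_nhds x one_pos) (Eventually.of_forall fun y => ?_) ?_ ?_ ?_ ?_ ?_).2
  · exact (hF.uncurry_left y).aestronglyMeasurable
  · exact (hF.uncurry_left x).intervalIntegrable _ _
  · exact (hF'.uncurry_left x).aestronglyMeasurable
  · refine Eventually.of_forall fun t ht y hy => ?_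
    exact hC (y, t) ⟨hy, Set.uIoc_subset_uIcc ht⟩
  · exact intervalIntegrable_const
  · exact Eventually.of_forall fun t _ y _ => h y t

/-- Jointly continuous functions of two complex variables that are entire in each of them. -/
structure SeparatelyEntire (F : ℂ → ℂ → ℂ) : Prop where
  continuous : Continuous F.uncurry
  left : ∀ b, Differentiable ℂ fun a => F a b
  right : ∀ a, Differentiable ℂ (F a)

/-- Cauchy's formula on the unit circle around `z`. The radius can be fixed because `f` is entire,
so parameters enter the derivative through an integral over a fixed circle. -/
theorem deriv_eq_integral_circle {f : ℂ → ℂ} (hf : Differentiable ℂ f) (z : ℂ) :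
    deriv f z = (2 * Real.pi * Complex.I)⁻¹ *
      ∫ θ in (0 : ℝ)..2 * Real.pi, circleMap 0 1 θ * Complex.I *
        (((circleMap 0 1 θ) ^ 2)⁻¹ * f (z + circleMap 0 1 θ)) := by
  rw [← Complex.cderiv_eq_deriv isOpen_univ hf.differentiableOn one_pos (Set.subset_univ _),
    Complex.cderiv, circleIntegral]
  simp [circleMap]

theorem SeparatelyEntire.swap {F : ℂ → ℂ → ℂ} (hF : SeparatelyEntire F) :
    SeparatelyEntire fun a b => F b a :=
  ⟨hF.continuous.comp continuous_swap, hF.right, hF.left⟩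

theorem SeparatelyEntire.continuous_deriv_left {F : ℂ → ℂ → ℂ} (hF : SeparatelyEntire F) :
    Continuous (Function.uncurry fun a b => deriv (fun x => F x b) a) := by
  have : (Function.uncurry fun a b => deriv (fun x => F x b) a) =
      fun p : ℂ × ℂ => (2 * Real.pi * Complex.I)⁻¹ *
      ∫ θ in (0 : ℝ)..2 * Real.pi, circleMap 0 1 θ * Complex.I *
        (((circleMap 0 1 θ) ^ 2)⁻¹ * F (p.1 + circleMap 0 1 θ) p.2) := by
    ext ⟨a, b⟩
    exact deriv_eq_integral_circle (hF.left b) a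
  rw [this]
  refine continuous_const.mul ?_
  apply intervalIntegral.continuous_parametric_intervalIntegral_of_continuous'
  have h1 : Continuous fun q : (ℂ × ℂ) × ℝ => circleMap 0 1 q.2 :=
    (continuous_circleMap 0 1).comp continuous_snd
  refine (h1.mul continuous_const).mul (((h1.pow 2).inv₀ fun q => ?_).mul ?_)
  · exact pow_ne_zero _ (circleMap_ne_center one_ne_zero)
  · exact hF.continuous.comp (((continuous_fst.comp continuous_fst).add h1).prodMk
      (continuous_snd.comp continuous_fst))

theorem SeparatelyEntire.deriv_left {F : ℂ → ℂ → ℂ} (hF : SeparatelyEntire F) :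
    SeparatelyEntire fun a b => deriv (fun x => F x b) a where
  continuous := hF.continuous_deriv_left
  left b := (hF.left b).contDiff.differentiable_deriv_two
  right a := by
    have : (fun b => deriv (fun x => F x b) a) =
      fun b => (2 * Real.pi * Complex.I)⁻¹ *
      ∫ θ in (0 : ℝ)..2 * Real.pi, circleMap 0 1 θ * Complex.I *
        (((circleMap 0 1 θ) ^ 2)⁻¹ * F (a + circleMap 0 1 θ) b) := by
      ext b
      exact deriv_eq_integral_circle (hF.left b) a
    rw [this]
    intro b
    have h1 : Continuous fun q : ℂ × ℝ => circleMap 0 1 q.2 :=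
      (continuous_circleMap 0 1).comp continuous_snd
    have h2 : Continuous fun q : ℂ × ℝ => ((circleMap 0 1 q.2) ^ 2)⁻¹ :=
      (h1.pow 2).inv₀ fun q => pow_ne_zero _ (circleMap_ne_center one_ne_zero)
    refine DifferentiableAt.const_mul (HasDerivAt.differentiableAt
      (hasDerivAt_intervalIntegral_of_continuous (F' := fun b θ => circleMap 0 1 θ * Complex.I *
        (((circleMap 0 1 θ) ^ 2)⁻¹ * deriv (F (a + circleMap 0 1 θ)) b)) _ _ ?_ ?_ ?_ b)) _
    · exact (h1.mul continuous_const).mul (h2.mul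
        (hF.continuous.comp ((continuous_const.add h1).prodMk continuous_fst)))
    · exact (h1.mul continuous_const).mul (h2.mul
        (hF.swap.continuous_deriv_left.comp (continuous_fst.prodMk (continuous_const.add h1))))
    · intro x t
      exact ((hF.right _ x).hasDerivAt.const_mul _).const_mul _

theorem SeparatelyEntire.hasFDerivAt {F : ℂ → ℂ → ℂ} (hF : SeparatelyEntire F) (p : ℂ × ℂ) :
    HasFDerivAt F.uncurry ((deriv (fun x => F x p.2) p.1) • ContinuousLinearMap.fst ℂ ℂ ℂ +
      (deriv (F p.1) p.2) • ContinuousLinearMap.snd ℂ ℂ ℂ) p := by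
  have := (hasStrictFDerivAt_uncurry_coprod (𝕜 := ℂ) (u := p) (f := F)
    (f₁ := fun a b => ContinuousLinearMap.toSpanSingleton ℂ (deriv (fun x => F x b) a))
    (f₂ := fun a b => ContinuousLinearMap.toSpanSingleton ℂ (deriv (F a) b))
    (Eventually.of_forall fun v => (hF.left v.2 v.1).hasDerivAt.hasFDerivAt)
    (Eventually.of_forall fun v => (hF.right v.1 v.2).hasDerivAt.hasFDerivAt) ?_ ?_).hasFDerivAt
  · refine HasFDerivAt.congr_fderiv this ?_
    ext <;> simp [Function.HasUncurry.uncurry]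
  · exact ((ContinuousLinearMap.toSpanSingletonCLE (𝕜 := ℂ) (E := ℂ)).continuous.comp
      hF.continuous_deriv_left).continuousAt
  · exact ((ContinuousLinearMap.toSpanSingletonCLE (𝕜 := ℂ) (E := ℂ)).continuous.comp
      (hF.swap.continuous_deriv_left.comp continuous_swap)).continuousAt

/-- Both partial derivatives are again separately entire and jointly continuous, so they form the
total derivative and the induction repeats on them. -/
theorem SeparatelyEntire.contDiff {F : ℂ → ℂ → ℂ} (hF : SeparatelyEntire F) (n : ℕ) :
    ContDiff ℂ n F.uncurry := by
  induction n generalizing F with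
  | zero => simpa using hF.continuous
  | succ n ih =>
    rw [Nat.cast_add, Nat.cast_one, contDiff_succ_iff_hasFDerivAt]
    refine ⟨_, ?_, hF.hasFDerivAt⟩
    exact ((ih hF.deriv_left).smul contDiff_const).add
      (((ih hF.swap.deriv_left).comp (contDiff_snd.prodMk contDiff_fst)).smul contDiff_const)

/-! ### Wirtinger derivatives by polarization -/

theorem wirtinger_iterate_congr {f g : ℂ → ℂ} {z : ℂ} (h : f =ᶠ[𝓝 z] g) (k : ℕ) :
    wirtinger^[k] f =ᶠ[𝓝 z] wirtinger^[k] g := by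
  induction k generalizing f g with
  | zero => exact h
  | succ k ih =>
    refine ih ?_
    filter_upwards [h.eventuallyEq_nhds] with y hy
    simp only [wirtinger, hy.fderiv_eq]

/-- With A the complex derivative of F, the real directional derivatives are A(1, 1) and A(i, -i) =
iA(1, -1). The Wirtinger combination is (A(1, 1) + A(1, -1))/2, in which the z̄-direction cancels.
-/
theorem wirtinger_comp_conj {F : ℂ × ℂ → ℂ} {z : ℂ}
    (hF : DifferentiableAt ℂ F (z, starRingEnd ℂ z)) :
    wirtinger (fun y => F (y, starRingEnd ℂ y)) z =
      fderiv ℂ F (z, starRingEnd ℂ z) (1, 0) := by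
  set A := fderiv ℂ F (z, starRingEnd ℂ z) with hA
  have h1 : HasFDerivAt (fun y : ℂ => (y, starRingEnd ℂ y))
      ((ContinuousLinearMap.id ℝ ℂ).prod (Complex.conjCLE : ℂ →L[ℝ] ℂ)) z :=
    (hasFDerivAt_id z).prodMk Complex.conjCLE.hasFDerivAt
  have h2 := ((hF.hasFDerivAt.restrictScalars ℝ).comp z h1).fderiv
  have h3 : fderiv ℝ (fun y => F (y, starRingEnd ℂ y)) z = _ := h2
  have h4 : A (Complex.I, -Complex.I) = Complex.I * A (1, -1) := by
    rw [← smul_eq_mul, ← map_smul]; simp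
  have h5 : A (1, 1) + A (1, -1) = 2 * A (1, 0) := by
    rw [← map_add, ← smul_eq_mul, ← map_smul]; norm_num
  rw [wirtinger, h3]
  simp only [ContinuousLinearMap.comp_apply, ContinuousLinearMap.prod_apply,
    ContinuousLinearMap.coe_restrictScalars', ContinuousLinearMap.id_apply,
    ContinuousLinearEquiv.coe_coe, Complex.conjCLE_apply, map_one, Complex.conj_I, ← hA, h4]
  linear_combination (1 / 2) * h5 - (1 / 2) * A (1, -1) * Complex.I_sq

/-- Iterated Wirtinger derivatives of `F (z, z̄)`, for holomorphic `F`, are obtained by treating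
`z` and `z̄` as independent variables. -/
theorem wirtinger_iterate_comp_conj (k : ℕ) {F : ℂ × ℂ → ℂ} {z : ℂ}
    (hF : ContDiffAt ℂ k F (z, starRingEnd ℂ z)) :
    wirtinger^[k] (fun y => F (y, starRingEnd ℂ y)) z =
      iteratedDeriv k (fun s => F (z + s, starRingEnd ℂ z)) 0 := by
  induction k generalizing F with
  | zero => simp
  | succ k ih =>
    have hev : ∀ᶠ p in 𝓝 (z, starRingEnd ℂ z), DifferentiableAt ℂ F p := by
      filter_upwards [hF.eventually (by simp)] with p hp
      exact hp.differentiableAt (by simp)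
    have hc : Tendsto (fun y : ℂ => (y, starRingEnd ℂ y)) (𝓝 z) (𝓝 (z, starRingEnd ℂ z)) :=
      (continuous_id.prodMk Complex.continuous_conj).tendsto z
    have hs : Tendsto (fun s : ℂ => (z + s, starRingEnd ℂ z)) (𝓝 0) (𝓝 (z, starRingEnd ℂ z)) := by
      have : Continuous fun s : ℂ => (z + s, starRingEnd ℂ z) := by fun_prop
      simpa using this.tendsto 0
    have hD : ContDiffAt ℂ k (fun p => fderiv ℂ F p (1, 0)) (z, starRingEnd ℂ z) :=
      (hF.fderiv_right (m := k) (by simp)).clm_apply contDiffAt_const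
    rw [Function.iterate_succ_apply, (wirtinger_iterate_congr (g := fun y =>
      fderiv ℂ F (y, starRingEnd ℂ y) (1, 0)) ?_ k).eq_of_nhds, ih hD, iteratedDeriv_succ']
    · refine (Filter.EventuallyEq.iteratedDeriv_eq k ?_).symm
      filter_upwards [hs.eventually hev] with s hs
      have h1 : HasDerivAt (fun s : ℂ => (z + s, starRingEnd ℂ z)) (1, 0) s :=
        ((hasDerivAt_id s).const_add z).prodMk (hasDerivAt_const s _)
      exact (hs.hasFDerivAt.comp_hasDerivAt s h1).deriv
    · filter_upwards [hc.eventually hev] with y hy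
      exact wirtinger_comp_conj hy

/-! ### The complex error function -/

/-- The entire function `M` with `erf z = (2 / √π) z M(z²)`. -/
def erfKernel (v : ℂ) : ℂ := ∫ s in (0 : ℝ)..1, Complex.exp (-((s : ℂ) ^ 2 * v))

theorem erf_eq_erfKernel (z : ℂ) :
    erf z = 2 / (Real.sqrt Real.pi : ℂ) * (z * erfKernel (z ^ 2)) := by
  simp only [erf, erfKernel, mul_pow]

theorem hasDerivAt_erfKernel (v : ℂ) :
    HasDerivAt erfKernel
      (∫ s in (0 : ℝ)..1, Complex.exp (-((s : ℂ) ^ 2 * v)) * -((s : ℂ) ^ 2)) v := by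
  refine hasDerivAt_intervalIntegral_of_continuous
    (F := fun v s => Complex.exp (-((s : ℂ) ^ 2 * v)))
    (F' := fun v s => Complex.exp (-((s : ℂ) ^ 2 * v)) * -((s : ℂ) ^ 2)) 0 1 ?_ ?_ ?_ v
  · simp only [Function.uncurry_def]; fun_prop
  · simp only [Function.uncurry_def]; fun_prop
  · intro x t
    simpa using ((((hasDerivAt_id x).const_mul ((t : ℂ) ^ 2)).neg).cexp)

theorem differentiable_erfKernel : Differentiable ℂ erfKernel := fun v =>
  (hasDerivAt_erfKernel v).differentiableAt

/-- Integrate the s-derivative of s·exp(-s²v) over [0, 1]. -/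
theorem erfKernel_ode (v : ℂ) :
    2 * v * deriv erfKernel v + erfKernel v = Complex.exp (-v) := by
  have h1 : ∀ s : ℝ, HasDerivAt (fun s : ℝ => (s : ℂ) * Complex.exp (-((s : ℂ) ^ 2 * v)))
      (2 * v * (Complex.exp (-((s : ℂ) ^ 2 * v)) * -((s : ℂ) ^ 2)) +
        Complex.exp (-((s : ℂ) ^ 2 * v))) s := by
    intro s
    have h2 : HasDerivAt (fun s : ℂ => s * Complex.exp (-(s ^ 2 * v)))
        (2 * v * (Complex.exp (-((s : ℂ) ^ 2 * v)) * -((s : ℂ) ^ 2)) +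
        Complex.exp (-((s : ℂ) ^ 2 * v))) (s : ℂ) := by
      have := (hasDerivAt_id (s : ℂ)).mul
        ((((hasDerivAt_id (s : ℂ)).pow 2).mul_const v).neg).cexp
      refine this.congr_deriv ?_
      simp; ring
    exact h2.comp_ofReal
  have h3 := intervalIntegral.integral_eq_sub_of_hasDerivAt (a := 0) (b := 1) (fun s _ => h1 s)
    (Continuous.intervalIntegrable (by fun_prop) _ _)
  rw [intervalIntegral.integral_add (Continuous.intervalIntegrable (by fun_prop) _ _)
    (Continuous.intervalIntegrable (by fun_prop) _ _), intervalIntegral.integral_const_mul] at h3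
  rw [(hasDerivAt_erfKernel v).deriv, erfKernel, h3]
  simp

/-- The factor `E` is kept inside the integral because in the application exp(-s²v) may grow like a
Gaussian in n, and only its product with the theta term is small for every s. -/
theorem norm_erfKernel_mul_le {v E : ℂ} {B : ℝ}
    (h : ∀ s ∈ Set.Icc (0 : ℝ) 1, ‖Complex.exp (-((s : ℂ) ^ 2 * v)) * E‖ ≤ B) :
    ‖erfKernel v * E‖ ≤ B := by
  rw [erfKernel, ← intervalIntegral.integral_mul_const]
  refine (intervalIntegral.norm_integral_le_of_norm_le_const (C := B) fun s hs => h s ?_).trans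
    (by simp)
  rw [Set.uIoc_of_le zero_le_one] at hs
  exact ⟨hs.1.le, hs.2⟩

theorem hasDerivAt_erf (z : ℂ) :
    HasDerivAt erf (2 / (Real.sqrt Real.pi : ℂ) * Complex.exp (-z ^ 2)) z := by
  rw [funext erf_eq_erfKernel, ← erfKernel_ode (z ^ 2)]
  have := ((hasDerivAt_id z).mul
    ((differentiable_erfKernel (z ^ 2)).hasDerivAt.comp z (hasDerivAt_pow 2 z))).const_mul
    (2 / (Real.sqrt Real.pi : ℂ))
  refine this.congr_deriv ?_
  simp only [Function.comp_apply, id, one_mul]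
  push_cast
  ring

theorem erf_zero : erf 0 = 0 := by simp [erf]

theorem erf_neg (z : ℂ) : erf (-z) = -erf z := by
  rw [erf_eq_erfKernel, erf_eq_erfKernel]; ring_nf

theorem erf_add_sub_erf (z v : ℂ) :
    erf (z + v) - erf z =
      ∫ r in (0 : ℝ)..1, 2 / (Real.sqrt Real.pi : ℂ) * Complex.exp (-(z + r * v) ^ 2) * v := by
  have h1 : ∀ r : ℝ, HasDerivAt (fun r : ℝ => erf (z + r * v))
      (2 / (Real.sqrt Real.pi : ℂ) * Complex.exp (-(z + r * v) ^ 2) * v) r := by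
    intro r
    have : HasDerivAt (fun r : ℂ => erf (z + r * v))
      (2 / (Real.sqrt Real.pi : ℂ) * Complex.exp (-(z + r * v) ^ 2) * v) (r : ℂ) := by
      have h2 : HasDerivAt (fun r : ℂ => z + r * v) v (r : ℂ) := by
        simpa using ((hasDerivAt_id (r : ℂ)).mul_const v).const_add z
      exact (hasDerivAt_erf _).comp (r : ℂ) h2
    exact this.comp_ofReal
  rw [intervalIntegral.integral_eq_sub_of_hasDerivAt (fun r _ => h1 r)
    (Continuous.intervalIntegrable (by fun_prop) _ _)]
  simp

theorem tendsto_integral_gaussian :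
    Tendsto (fun R : ℝ => ∫ x in (0 : ℝ)..R, Real.exp (-x ^ 2)) atTop
      (𝓝 (Real.sqrt Real.pi / 2)) := by
  have h := MeasureTheory.intervalIntegral_tendsto_integral_Ioi (μ := MeasureTheory.volume) (0 : ℝ)
    (f := fun x : ℝ => Real.exp (-1 * x ^ 2)) (integrable_exp_neg_mul_sq one_pos).integrableOn
    tendsto_id
  rw [integral_gaussian_Ioi, div_one] at h
  simpa using h

theorem integral_gaussian_le {R : ℝ} (hR : 0 ≤ R) :
    ∫ x in (0 : ℝ)..R, Real.exp (-x ^ 2) ≤ Real.sqrt Real.pi / 2 := by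
  refine ge_of_tendsto tendsto_integral_gaussian ?_
  filter_upwards [eventually_ge_atTop R] with S hS
  refine intervalIntegral.integral_mono_interval le_rfl hR hS ?_
    (Continuous.intervalIntegrable (by fun_prop) _ _)
  exact Eventually.of_forall fun x => (Real.exp_pos _).le

theorem mul_integral_gaussian (R : ℝ) :
    ∫ r in (0 : ℝ)..1, Real.exp (-(r * R) ^ 2) * R = ∫ x in (0 : ℝ)..R, Real.exp (-x ^ 2) := by
  have := intervalIntegral.mul_integral_comp_mul_right (a := 0) (b := 1)
    (f := fun x : ℝ => Real.exp (-x ^ 2)) R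
  rw [zero_mul, one_mul] at this
  rw [intervalIntegral.integral_mul_const, mul_comm, this]

theorem erf_ofReal (R : ℝ) :
    erf (R : ℂ) =
      ((2 / Real.sqrt Real.pi * ∫ x in (0 : ℝ)..R, Real.exp (-x ^ 2) : ℝ) : ℂ) := by
  have := erf_add_sub_erf 0 R
  rw [zero_add, erf_zero, sub_zero] at this
  rw [this, ← mul_integral_gaussian, ← intervalIntegral.integral_const_mul,
    ← intervalIntegral.integral_ofReal]
  congr 1 with r
  push_cast
  rw [zero_add, mul_assoc]

theorem tendsto_erf_ofReal : Tendsto (fun R : ℝ => erf (R : ℂ)) atTop (𝓝 1) := by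
  have h := tendsto_integral_gaussian.const_mul (2 / Real.sqrt Real.pi)
  have h2 : 2 / Real.sqrt Real.pi * (Real.sqrt Real.pi / 2) = 1 := by
    have : Real.sqrt Real.pi ≠ 0 := by positivity
    field_simp
  rw [h2] at h
  simp only [erf_ofReal]
  exact_mod_cast (Complex.continuous_ofReal.tendsto 1).comp h

theorem norm_exp_neg_sq (z : ℂ) : ‖Complex.exp (-z ^ 2)‖ = Real.exp (z.im ^ 2 - z.re ^ 2) := by
  rw [Complex.norm_exp]
  congr 1
  simp [pow_two]

theorem norm_two_div_sqrt_pi :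
    ‖(2 / (Real.sqrt Real.pi : ℂ) : ℂ)‖ = 2 / Real.sqrt Real.pi := by
  rw [norm_div, Complex.norm_real, Complex.norm_two, Real.norm_of_nonneg (Real.sqrt_nonneg _)]

/-- The values at y + R and at its real part differ by an integral over a vertical segment of fixed
length, on which the integrand decays like a Gaussian in R. -/
theorem tendsto_erf_add_real (y : ℂ) : Tendsto (fun R : ℝ => erf (y + R)) atTop (𝓝 1) := by
  set c := 2 / Real.sqrt Real.pi with hc
  have hre : Tendsto (fun R : ℝ => y.re + R) atTop atTop :=
    tendsto_atTop_add_const_left _ _ tendsto_id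
  have h1 : Tendsto (fun R : ℝ => erf ((y.re + R : ℝ) : ℂ)) atTop (𝓝 1) :=
    tendsto_erf_ofReal.comp hre
  have h2 : Tendsto (fun R : ℝ => erf (y + R) - erf ((y.re + R : ℝ) : ℂ)) atTop (𝓝 0) := by
    refine squeeze_zero_norm (a := fun R => c * Real.exp (y.im ^ 2 - (y.re + R) ^ 2) * |y.im|)
      (fun R => ?_) ?_
    · have : y + R = ((y.re + R : ℝ) : ℂ) + (y.im : ℂ) * Complex.I := by
        apply Complex.ext <;> simp
      rw [this, erf_add_sub_erf]
      refine (intervalIntegral.norm_integral_le_of_norm_le_const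
        (C := c * Real.exp (y.im ^ 2 - (y.re + R) ^ 2) * |y.im|) fun r hr => ?_).trans (by simp)
      rw [Set.uIoc_of_le zero_le_one] at hr
      rw [norm_mul, norm_mul, norm_two_div_sqrt_pi, norm_exp_neg_sq]
      simp only [norm_mul, Complex.norm_I, mul_one, Complex.norm_real, Real.norm_eq_abs]
      have hr2 : r ^ 2 ≤ 1 := pow_le_one₀ hr.1.le hr.2
      refine mul_le_mul_of_nonneg_right (mul_le_mul_of_nonneg_left (Real.exp_le_exp.2 ?_)
        (by positivity)) (abs_nonneg _)
      simp only [Complex.add_im, Complex.add_re, Complex.ofReal_im, Complex.ofReal_re,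
        Complex.mul_im, Complex.mul_re, Complex.I_re, Complex.I_im]
      nlinarith [mul_le_mul_of_nonneg_right hr2 (sq_nonneg y.im)]
    · have h3 : Tendsto (fun R : ℝ => y.im ^ 2 - (y.re + R) ^ 2) atTop atBot :=
        tendsto_atBot_add_const_left _ _
          (tendsto_neg_atTop_atBot.comp ((tendsto_pow_atTop two_ne_zero).comp hre))
      have h4 := ((Real.tendsto_exp_atBot.comp h3).const_mul c).mul_const |y.im|
      simpa using h4
  simpa using h2.add h1

/-- Integrate along the horizontal ray from y. Since (y+x)² = y² + 2xy + x² and Re y ≥ 0, the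
integrand is at most |exp(-y²)|·exp(-x²), and the real Gaussian integral cancels the constant 2/√π.
-/
theorem norm_one_sub_erf_le {y : ℂ} (hy : 0 ≤ y.re) :
    ‖1 - erf y‖ ≤ ‖Complex.exp (-y ^ 2)‖ := by
  have h1 : Tendsto (fun R : ℝ => ‖erf (y + R) - erf y‖) atTop (𝓝 ‖1 - erf y‖) :=
    ((tendsto_erf_add_real y).sub_const _).norm
  refine le_of_tendsto h1 ?_
  filter_upwards [eventually_ge_atTop 0] with R hR
  have hpi : 0 < Real.sqrt Real.pi := by positivity
  rw [erf_add_sub_erf]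
  calc ‖∫ r in (0 : ℝ)..1, 2 / (Real.sqrt Real.pi : ℂ) * Complex.exp (-(y + r * R) ^ 2) * R‖
      ≤ ∫ r in (0 : ℝ)..1, 2 / Real.sqrt Real.pi * ‖Complex.exp (-y ^ 2)‖ *
          (Real.exp (-(r * R) ^ 2) * R) := by
        refine intervalIntegral.norm_integral_le_of_norm_le zero_le_one ?_
          (Continuous.intervalIntegrable (by fun_prop) _ _)
        refine Eventually.of_forall fun r hr => ?_
        rw [norm_mul, norm_mul, norm_two_div_sqrt_pi, norm_exp_neg_sq, norm_exp_neg_sq,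
          Complex.norm_real, Real.norm_of_nonneg hR, mul_assoc, mul_assoc, ← mul_assoc (Real.exp _),
          ← Real.exp_add]
        gcongr
        simp
        nlinarith [mul_nonneg (mul_nonneg hr.1.le hR) hy]
    _ = 2 / Real.sqrt Real.pi * ‖Complex.exp (-y ^ 2)‖ * ∫ x in (0 : ℝ)..R, Real.exp (-x ^ 2) := by
        rw [intervalIntegral.integral_const_mul, mul_integral_gaussian]
    _ ≤ 2 / Real.sqrt Real.pi * ‖Complex.exp (-y ^ 2)‖ * (Real.sqrt Real.pi / 2) := by
        gcongr
        exact integral_gaussian_le hR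
    _ = ‖Complex.exp (-y ^ 2)‖ := by field_simp

/-! ### The error series: convergence, holomorphy, differential equation -/

theorem summable_abs_add_mul_exp {m : ℝ} (hm : 0 < m) (a C D : ℝ) :
    Summable fun n : ℤ => (|(n : ℝ)| + a) * Real.exp (D + C * |(n : ℝ)| - Real.pi * m * n ^ 2) := by
  have h (k : ℕ) := summable_pow_mul_jacobiTheta₂_term_bound (C / (2 * Real.pi)) hm k
  have h2 := (((h 1).add ((h 0).mul_left a)).mul_left (Real.exp D))
  refine h2.congr fun n => ?_
  have : Real.exp (D + C * |(n : ℝ)| - Real.pi * m * n ^ 2) = Real.exp D *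
      Real.exp (-Real.pi * (m * n ^ 2 - 2 * (C / (2 * Real.pi)) * |(n : ℝ)|)) := by
    rw [← Real.exp_add]
    congr 1
    field_simp
    ring
  rw [this]
  push_cast
  ring

theorem thetaTerm_eq_exp (n : ℤ) (z : ℂ) (τ : ℍ) :
    thetaTerm n z τ = (-1 : ℂ) ^ n * Complex.exp (2 * Real.pi * Complex.I * ((n : ℂ) + 1 / 2) * z +
      Real.pi * Complex.I * ((n : ℂ) + 1 / 2) ^ 2 * (τ : ℂ)) := by
  rw [thetaTerm, Complex.exp_add, mul_assoc]

theorem norm_neg_one_zpow (n : ℤ) : ‖(-1 : ℂ) ^ n‖ = 1 := by simp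

/-- The summand of the series for `psiHat`, up to a factor not depending on `n`, with the real
parameter `Im z / Im τ` replaced by a complex variable `α`. -/
def errTerm (n : ℤ) (z α : ℂ) (τ : ℍ) (w : ℂ) : ℂ :=
  ((n : ℂ) + 1 / 2 + α) * (erfKernel (-(Real.pi * Complex.I * (w - τ) * ((n : ℂ) + 1 / 2 + α) ^ 2)) *
    thetaTerm n z τ)

/-- The entire function of `z` and `α` underlying `psiHat`. -/
def errSum (z α : ℂ) (τ : ℍ) (w : ℂ) : ℂ := ∑' n : ℤ, errTerm n z α τ w

/-- The part of the exponent quadratic in n + 1/2 is πi(n+1/2)²((1-s²)τ + s²w). This is a convex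
combination of τ and w, so its imaginary part controls the decay uniformly in s; everything else is
at most linear in n. The case s = 0, α = 0 bounds the theta terms alone. -/
theorem norm_exp_mul_thetaTerm_le {m R : ℝ} {n : ℤ} {z α w : ℂ} {τ : ℍ}
    (hτ : m ≤ τ.im) (hw : m ≤ w.im) (hm : 0 < m) (hz : ‖z‖ ≤ R) (hα : ‖α‖ ≤ R)
    (hwτ : ‖w - τ‖ ≤ R) {s : ℝ} (hs : s ∈ Set.Icc (0 : ℝ) 1) :
    ‖Complex.exp (-((s : ℂ) ^ 2 * -(Real.pi * Complex.I * (w - τ) * ((n : ℂ) + 1 / 2 + α) ^ 2))) *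
      thetaTerm n z τ‖ ≤ Real.exp (Real.pi * (R ^ 2 + R + R ^ 3) +
        Real.pi * (m + 2 * R ^ 2 + 2 * R) * |(n : ℝ)| - Real.pi * m * n ^ 2) := by
  have hR : 0 ≤ R := (norm_nonneg z).trans hz
  have hs2 : s ^ 2 ≤ 1 := pow_le_one₀ hs.1 hs.2
  have hs0 := sq_nonneg s
  set ν : ℝ := n + 1 / 2 with hν
  have hνc : (n : ℂ) + 1 / 2 = (ν : ℂ) := by simp [hν]
  have hν1 : |ν| ≤ |(n : ℝ)| + 1 / 2 := by
    refine (abs_add_le _ _).trans ?_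
    rw [abs_of_pos (show (0 : ℝ) < 1 / 2 by norm_num)]
  have hν2 : (n : ℝ) ^ 2 - |(n : ℝ)| ≤ ν ^ 2 := by
    rw [hν]; nlinarith [neg_abs_le (n : ℝ)]
  set E : ℂ := (s : ℂ) ^ 2 * (w - τ) * (2 * ν * α + α ^ 2) + 2 * ν * z with hE
  have hEn : ‖E‖ ≤ R * (2 * |ν| * R + R ^ 2) + 2 * |ν| * R := by
    refine (norm_add_le _ _).trans (add_le_add ?_ ?_)
    · rw [norm_mul, norm_mul]
      have h1 : ‖(s : ℂ) ^ 2‖ ≤ 1 := by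
        rw [norm_pow, Complex.norm_real, Real.norm_of_nonneg hs.1]; exact hs2
      have h2 : ‖(2 * ν * α + α ^ 2 : ℂ)‖ ≤ 2 * |ν| * R + R ^ 2 := by
        refine (norm_add_le _ _).trans (add_le_add ?_ ?_)
        · simp only [norm_mul, Complex.norm_two, Complex.norm_real, Real.norm_eq_abs]
          gcongr
        · rw [norm_pow]; gcongr
      calc ‖(s : ℂ) ^ 2‖ * ‖w - τ‖ * ‖(2 * ν * α + α ^ 2 : ℂ)‖
          ≤ 1 * R * (2 * |ν| * R + R ^ 2) := by gcongr
        _ = _ := by ring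
    · simp only [norm_mul, Complex.norm_two, Complex.norm_real, Real.norm_eq_abs]
      gcongr
  rw [thetaTerm_eq_exp, mul_left_comm, norm_mul, norm_neg_one_zpow, one_mul, ← Complex.exp_add,
    Complex.norm_exp, Real.exp_le_exp]
  have hexp : -((s : ℂ) ^ 2 * -(Real.pi * Complex.I * (w - τ) * ((n : ℂ) + 1 / 2 + α) ^ 2)) +
      (2 * Real.pi * Complex.I * ((n : ℂ) + 1 / 2) * z +
      Real.pi * Complex.I * ((n : ℂ) + 1 / 2) ^ 2 * (τ : ℂ)) =
      ((Real.pi * ν ^ 2 * (1 - s ^ 2) : ℝ) : ℂ) * (Complex.I * τ) +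
      ((Real.pi * ν ^ 2 * s ^ 2 : ℝ) : ℂ) * (Complex.I * w) + (Real.pi : ℂ) * (Complex.I * E) := by
    rw [hνc, hE]; push_cast; ring
  have hIE : (Complex.I * E).re ≤ ‖E‖ := by
    refine (Complex.re_le_norm _).trans ?_
    simp
  rw [hexp]
  simp only [Complex.add_re, Complex.re_ofReal_mul]
  have e1 : (Complex.I * (τ : ℂ)).re = -τ.im := by simp
  have e2 : (Complex.I * w).re = -w.im := by simp
  rw [e1, e2]
  have hpi := Real.pi_pos
  have k1 : ν ^ 2 * m ≤ ν ^ 2 * (1 - s ^ 2) * τ.im + ν ^ 2 * s ^ 2 * w.im := by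
    have := mul_le_mul_of_nonneg_left hτ (mul_nonneg (sq_nonneg ν) (sub_nonneg.2 hs2))
    have := mul_le_mul_of_nonneg_left hw (mul_nonneg (sq_nonneg ν) hs0)
    nlinarith
  have k2 : R * (2 * |ν| * R + R ^ 2) + 2 * |ν| * R ≤
      R * (2 * (|(n : ℝ)| + 1 / 2) * R + R ^ 2) + 2 * (|(n : ℝ)| + 1 / 2) * R := by gcongr
  have k3 := mul_le_mul_of_nonneg_left hν2 hm.le
  have key : -(ν ^ 2 * (1 - s ^ 2) * τ.im + ν ^ 2 * s ^ 2 * w.im) + (Complex.I * E).re ≤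
      (R ^ 2 + R + R ^ 3) + (m + 2 * R ^ 2 + 2 * R) * |(n : ℝ)| - m * n ^ 2 := by
    nlinarith
  have := mul_le_mul_of_nonneg_left key hpi.le
  nlinarith

theorem exists_summable_bound_errTerm {m : ℝ} (hm : 0 < m) (R : ℝ) :
    ∃ u : ℤ → ℝ, Summable u ∧ ∀ (n : ℤ) (z α : ℂ) (τ : ℍ) (w : ℂ), m ≤ τ.im → m ≤ w.im →
      ‖z‖ ≤ R → ‖α‖ ≤ R → ‖w - τ‖ ≤ R → ‖errTerm n z α τ w‖ ≤ u n := by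
  refine ⟨_, summable_abs_add_mul_exp hm (1 / 2 + R) (Real.pi * (m + 2 * R ^ 2 + 2 * R))
    (Real.pi * (R ^ 2 + R + R ^ 3)), fun n z α τ w hτ hw hz hα hwτ => ?_⟩
  rw [errTerm, norm_mul]
  refine mul_le_mul ?_ (norm_erfKernel_mul_le fun s hs =>
    norm_exp_mul_thetaTerm_le hτ hw hm hz hα hwτ hs) (norm_nonneg _) ?_
  · refine (norm_add_le _ _).trans ?_
    rw [← add_assoc]
    refine add_le_add ((norm_add_le _ _).trans ?_) hα
    simp
  · have := (norm_nonneg z).trans hz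
    positivity

theorem summable_errTerm (z α : ℂ) (τ : ℍ) {w : ℂ} (hw : 0 < w.im) :
    Summable fun n => errTerm n z α τ w := by
  obtain ⟨u, hu, h⟩ := exists_summable_bound_errTerm (lt_min τ.im_pos hw)
    (max (max ‖z‖ ‖α‖) ‖w - τ‖)
  exact hu.of_norm_bounded fun n => h n z α τ w (min_le_left _ _) (min_le_right _ _)
    (by simp) (by simp) (by simp)

theorem differentiable_thetaTerm (n : ℤ) (τ : ℍ) : Differentiable ℂ fun z => thetaTerm n z τ := by
  unfold thetaTerm; fun_prop

theorem continuous_errTerm (n : ℤ) (τ : ℍ) (w : ℂ) :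
    Continuous fun p : ℂ × ℂ => errTerm n p.1 p.2 τ w := by
  unfold errTerm
  have := differentiable_erfKernel.continuous
  have := (differentiable_thetaTerm n τ).continuous
  fun_prop

theorem separatelyEntire_errSum (τ : ℍ) {w : ℂ} (hw : 0 < w.im) :
    SeparatelyEntire fun z α => errSum z α τ w := by
  have hm := lt_min τ.im_pos hw
  refine ⟨?_, fun α => ?_, fun z => ?_⟩
  · rw [continuous_iff_continuousAt]
    intro p
    obtain ⟨u, hu, h⟩ := exists_summable_bound_errTerm hm (max (‖p‖ + 1) ‖w - τ‖)
    refine (continuousOn_tsum (s := Metric.ball 0 (‖p‖ + 1)) (u := u)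
      (f := fun n (p : ℂ × ℂ) => errTerm n p.1 p.2 τ w)
      (fun n => (continuous_errTerm n τ w).continuousOn) hu ?_).continuousAt
      (Metric.isOpen_ball.mem_nhds (by simp))
    intro n q hq
    rw [mem_ball_zero_iff] at hq
    exact h n q.1 q.2 τ w (min_le_left _ _) (min_le_right _ _)
      (((norm_fst_le q).trans hq.le).trans (le_max_left _ _))
      (((norm_snd_le q).trans hq.le).trans (le_max_left _ _)) (le_max_right _ _)
  · intro z
    obtain ⟨u, hu, h⟩ := exists_summable_bound_errTerm hm (max (max (‖z‖ + 1) ‖α‖) ‖w - τ‖)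
    refine (Complex.differentiableOn_tsum_of_summable_norm (U := Metric.ball 0 (‖z‖ + 1)) (u := u)
      (F := fun n z => errTerm n z α τ w) hu (fun n => Differentiable.differentiableOn ?_)
      Metric.isOpen_ball ?_).differentiableAt (Metric.isOpen_ball.mem_nhds (by simp))
    · exact ((differentiable_thetaTerm n τ).const_mul _).const_mul _
    intro n q hq
    rw [mem_ball_zero_iff] at hq
    exact h n q α τ w (min_le_left _ _) (min_le_right _ _)
      (hq.le.trans (by simp)) (by simp) (by simp)
  · intro α
    obtain ⟨u, hu, h⟩ := exists_summable_bound_errTerm hm (max (max (‖α‖ + 1) ‖z‖) ‖w - τ‖)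
    refine (Complex.differentiableOn_tsum_of_summable_norm (U := Metric.ball 0 (‖α‖ + 1)) (u := u)
      (F := fun n α => errTerm n z α τ w) hu (fun n => Differentiable.differentiableOn ?_)
      Metric.isOpen_ball ?_).differentiableAt (Metric.isOpen_ball.mem_nhds (by simp))
    · have := differentiable_erfKernel
      unfold errTerm
      fun_prop
    intro n q hq
    rw [mem_ball_zero_iff] at hq
    exact h n z q τ w (min_le_left _ _) (min_le_right _ _)
      (by simp) (hq.le.trans (by simp)) (by simp)

/-- The theta series of weight `3/2` in `w` whose Eichler-type integral is `errSum`. -/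
def thetaDeriv (z α : ℂ) (τ : ℍ) (w : ℂ) : ℂ :=
  ∑' n : ℤ, ((n : ℂ) + 1 / 2 + α) *
    (Complex.exp (Real.pi * Complex.I * (w - τ) * ((n : ℂ) + 1 / 2 + α) ^ 2) * thetaTerm n z τ)

theorem hasDerivAt_errTerm (n : ℤ) (z α : ℂ) (τ : ℍ) (w : ℂ) :
    HasDerivAt (errTerm n z α τ) (((n : ℂ) + 1 / 2 + α) *
      (deriv erfKernel (-(Real.pi * Complex.I * (w - τ) * ((n : ℂ) + 1 / 2 + α) ^ 2)) *
        -(Real.pi * Complex.I * ((n : ℂ) + 1 / 2 + α) ^ 2) * thetaTerm n z τ)) w := by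
  have h1 : HasDerivAt (fun w : ℂ => -(Real.pi * Complex.I * (w - τ) * ((n : ℂ) + 1 / 2 + α) ^ 2))
      (-(Real.pi * Complex.I * ((n : ℂ) + 1 / 2 + α) ^ 2)) w := by
    have := ((((hasDerivAt_id w).sub_const (τ : ℂ)).const_mul (Real.pi * Complex.I)).mul_const
      (((n : ℂ) + 1 / 2 + α) ^ 2)).neg
    exact this.congr_deriv (by ring)
  exact (((differentiable_erfKernel _).hasDerivAt.comp w h1).mul_const _).const_mul _

/-- Differentiating term by term and applying `erfKernel_ode` to each term replaces the error kernel
by a plain exponential. -/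
theorem errSum_ode (z α : ℂ) (τ : ℍ) {w : ℂ} (hw : 0 < w.im) :
    DifferentiableAt ℂ (errSum z α τ) w ∧
      2 * (w - τ) * deriv (errSum z α τ) w + errSum z α τ w = thetaDeriv z α τ w := by
  obtain ⟨u, hu, h⟩ := exists_summable_bound_errTerm (lt_min τ.im_pos (half_pos hw))
    (max (max ‖z‖ ‖α‖) (‖w - τ‖ + 1))
  -- A neighbourhood of `w` on which Im v stays away from 0 and v - τ stays bounded, so that one
  -- summable majorant serves all its points.
  set U : Set ℂ := {v | w.im / 2 < v.im} ∩ Metric.ball (τ : ℂ) (‖w - τ‖ + 1) with hU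
  have hUo : IsOpen U := (isOpen_lt continuous_const Complex.continuous_im).inter Metric.isOpen_ball
  have hwU : w ∈ U := ⟨by simpa using hw, by simp [dist_eq_norm]⟩
  have hd (n : ℤ) : DifferentiableOn ℂ (errTerm n z α τ) U := fun v _ =>
    (hasDerivAt_errTerm n z α τ v).differentiableAt.differentiableWithinAt
  have hb (n : ℤ) (v : ℂ) (hv : v ∈ U) : ‖errTerm n z α τ v‖ ≤ u n := by
    have h1 : w.im / 2 < v.im := hv.1
    have h2 : ‖v - τ‖ < ‖w - τ‖ + 1 := by simpa [dist_eq_norm] using hv.2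
    exact h n z α τ v (min_le_left _ _) ((min_le_right _ _).trans h1.le) (by simp) (by simp)
      (h2.le.trans (le_max_right _ _))
  refine ⟨(Complex.differentiableOn_tsum_of_summable_norm hu hd hUo hb).differentiableAt
    (hUo.mem_nhds hwU), ?_⟩
  have h1 := (Complex.hasSum_deriv_of_summable_norm hu hd hUo hb hwU).mul_left (2 * (w - τ))
  have h2 := h1.add (summable_errTerm z α τ hw).hasSum
  refine h2.tsum_eq.symm.trans (tsum_congr fun n => ?_)
  rw [(hasDerivAt_errTerm n z α τ w).deriv, errTerm]
  have := erfKernel_ode (-(Real.pi * Complex.I * (w - τ) * ((n : ℂ) + 1 / 2 + α) ^ 2))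
  rw [neg_neg] at this
  rw [← this]
  ring

/-- Inside the kernel the square root occurs only squared. The choice of branch is thus confined to
a prefactor independent of n. -/
theorem erf_mul_thetaTerm (n : ℤ) (z α : ℂ) (τ : ℍ) (w : ℂ) :
    erf (-Complex.I * Complex.sqrt (Real.pi * Complex.I * (w - τ)) * ((n : ℂ) + 1 / 2 + α)) *
      thetaTerm n z τ = 2 / (Real.sqrt Real.pi : ℂ) *
      (-Complex.I * Complex.sqrt (Real.pi * Complex.I * (w - τ))) * errTerm n z α τ w := by
  rw [erf_eq_erfKernel, errTerm]
  have : (-Complex.I * Complex.sqrt (Real.pi * Complex.I * (w - τ)) *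
      ((n : ℂ) + 1 / 2 + α)) ^ 2 =
      -(Real.pi * Complex.I * (w - τ) * ((n : ℂ) + 1 / 2 + α) ^ 2) := by
    have h : Complex.sqrt (Real.pi * Complex.I * (w - τ)) ^ 2 =
      Real.pi * Complex.I * (w - τ) := Complex.cpow_nat_inv_pow _ two_ne_zero
    rw [mul_pow, mul_pow, h, neg_sq, Complex.I_sq]
    ring
  rw [this]
  ring

theorem psiHat_eq_errSum (z : ℂ) (τ w : ℍ) :
    psiHat z τ w = Complex.I * (2 / (Real.sqrt Real.pi : ℂ) *
      (-Complex.I * Complex.sqrt (Real.pi * Complex.I * ((w : ℂ) - (τ : ℂ)))) *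
      errSum z ((z.im / τ.im : ℝ) : ℂ) τ w) := by
  rw [psiHat, errSum]
  congr 1
  rw [← tsum_mul_left]
  exact tsum_congr fun n => erf_mul_thetaTerm n z _ τ w

/-! ### Inversion formulas -/

theorem jacobiTheta_eq (z : ℂ) (τ : ℍ) :
    jacobiTheta z τ = Complex.I * (Complex.exp (Real.pi * Complex.I * z +
      Real.pi * Complex.I * τ / 4) * jacobiTheta₂ (z + 1 / 2 + τ / 2) τ) := by
  rw [jacobiTheta, jacobiTheta₂]
  congr 1
  rw [← tsum_mul_left]
  refine tsum_congr fun n => ?_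
  rw [thetaTerm_eq_exp, jacobiTheta₂_term, ← Complex.exp_pi_mul_I, ← Complex.exp_int_mul,
    ← Complex.exp_add, ← Complex.exp_add]
  congr 1
  ring

theorem differentiable_jacobiTheta (τ : ℍ) : Differentiable ℂ fun z => jacobiTheta z τ := by
  simp only [jacobiTheta_eq]
  intro z
  have : DifferentiableAt ℂ (fun z : ℂ => jacobiTheta₂ (z + 1 / 2 + τ / 2) τ) z :=
    DifferentiableAt.comp (f := fun z : ℂ => z + 1 / 2 + (τ : ℂ) / 2)
      (g := fun z => jacobiTheta₂ z τ) z
      (differentiableAt_jacobiTheta₂_fst (z + 1 / 2 + τ / 2) τ.im_pos) (by fun_prop)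
  fun_prop

/-- Expanding the square cancels τ in the term quadratic in n, so the modulus becomes `u` and τ
survives only in the elliptic variable and the prefactor. -/
theorem thetaDeriv_eq (z α : ℂ) (τ : ℍ) {u : ℂ} (hu : 0 < u.im) :
    thetaDeriv z α τ u =
      Complex.exp (Real.pi * Complex.I * (u / 4 + (z + (u - τ) * α) + (u - τ) * α ^ 2)) *
      ((1 / 2 + α) * jacobiTheta₂ (z + (u - τ) * α + u / 2 + 1 / 2) u +
        jacobiTheta₂' (z + (u - τ) * α + u / 2 + 1 / 2) u / (2 * Real.pi * Complex.I)) := by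
  have hpi : (Real.pi : ℂ) ≠ 0 := by exact_mod_cast Real.pi_ne_zero
  set y := z + (u - τ) * α + u / 2 + 1 / 2 with hy
  have h1 := (hasSum_jacobiTheta₂_term y hu).mul_left (1 / 2 + α)
  have h2 := (hasSum_jacobiTheta₂'_term y hu).div_const (2 * Real.pi * Complex.I)
  have h3 := (h1.add h2).mul_left
    (Complex.exp (Real.pi * Complex.I * (u / 4 + (z + (u - τ) * α) + (u - τ) * α ^ 2)))
  rw [thetaDeriv, ← h3.tsum_eq]
  refine tsum_congr fun n => ?_
  have h4 : Complex.exp (Real.pi * Complex.I * (u / 4 + (z + (u - τ) * α) + (u - τ) * α ^ 2)) *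
      jacobiTheta₂_term n y u =
      Complex.exp (Real.pi * Complex.I * (u - τ) * ((n : ℂ) + 1 / 2 + α) ^ 2) * thetaTerm n z τ := by
    rw [thetaTerm_eq_exp, jacobiTheta₂_term, ← Complex.exp_pi_mul_I, ← Complex.exp_int_mul,
      ← Complex.exp_add, ← Complex.exp_add, ← Complex.exp_add, hy]
    congr 1
    ring
  rw [← h4, jacobiTheta₂'_term]
  field_simp
  ring

theorem neg_I_mul_ne_zero {u : ℂ} (hu : 0 < u.im) : -Complex.I * u ≠ 0 := by
  refine mul_ne_zero (by simp) ?_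
  rintro rfl
  simp at hu

/-- `√(-iu)`, the automorphy factor of weight `1/2` of the inversion. -/
def sqrtNegI (u : ℂ) : ℂ := Complex.sqrt (-Complex.I * u)

theorem sqrtNegI_sq (u : ℂ) : sqrtNegI u ^ 2 = -Complex.I * u :=
  Complex.cpow_nat_inv_pow _ two_ne_zero

theorem sqrtNegI_ne_zero {u : ℂ} (hu : 0 < u.im) : sqrtNegI u ≠ 0 := by
  intro h
  have := sqrtNegI_sq u
  rw [h] at this
  exact neg_I_mul_ne_zero hu (by simpa using this.symm)

theorem hasDerivAt_sqrtNegI {u : ℂ} (hu : 0 < u.im) :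
    HasDerivAt sqrtNegI (sqrtNegI u / (2 * u)) u := by
  have hs : -Complex.I * u ∈ Complex.slitPlane := Or.inl (by simpa using hu)
  have h1 : DifferentiableAt ℂ sqrtNegI u :=
    (Complex.differentiableAt_sqrt hs).comp u (by fun_prop)
  have h2 := h1.hasDerivAt.pow 2
  have h3 : HasDerivAt (fun u : ℂ => -Complex.I * u) (-Complex.I) u := by
    simpa using (hasDerivAt_id u).const_mul (-Complex.I)
  have h4 : (sqrtNegI ^ 2) = fun u : ℂ => -Complex.I * u := funext sqrtNegI_sq
  rw [h4] at h2
  have h5 := h2.unique h3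
  have hu0 : u ≠ 0 := right_ne_zero_of_mul (neg_I_mul_ne_zero hu)
  refine h1.hasDerivAt.congr_deriv ?_
  have h6 := sqrtNegI_sq u
  have h7 := sqrtNegI_ne_zero hu
  simp only [Nat.cast_ofNat, Nat.add_one_sub_one, pow_one] at h5
  rw [eq_div_iff (mul_ne_zero two_ne_zero hu0)]
  refine mul_left_cancel₀ h7 ?_
  linear_combination u * h5 - h6

theorem jacobiTheta₂_inversion (y : ℂ) {u : ℂ} (hu : 0 < u.im) :
    jacobiTheta₂ (y / u) (-1 / u) =
      sqrtNegI u * Complex.exp (Real.pi * Complex.I * (y ^ 2 / u)) * jacobiTheta₂ y u := by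
  have h1 := sqrtNegI_ne_zero hu
  rw [jacobiTheta₂_functional_equation y u, one_div (2 : ℂ), ← Complex.sqrt, ← sqrtNegI]
  have : Complex.exp (-Real.pi * Complex.I * y ^ 2 / u) =
      (Complex.exp (Real.pi * Complex.I * (y ^ 2 / u)))⁻¹ := by
    rw [← Complex.exp_neg]; congr 1; ring
  rw [this]
  field_simp

theorem jacobiTheta₂'_inversion (y : ℂ) {u : ℂ} (hu : 0 < u.im) :
    jacobiTheta₂' (y / u) (-1 / u) =
      sqrtNegI u * Complex.exp (Real.pi * Complex.I * (y ^ 2 / u)) *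
        (u * jacobiTheta₂' y u + 2 * Real.pi * Complex.I * y * jacobiTheta₂ y u) := by
  have h1 := sqrtNegI_ne_zero hu
  have hu0 : u ≠ 0 := right_ne_zero_of_mul (neg_I_mul_ne_zero hu)
  rw [jacobiTheta₂'_functional_equation y u, one_div (2 : ℂ), ← Complex.sqrt, ← sqrtNegI]
  have : Complex.exp (-Real.pi * Complex.I * y ^ 2 / u) =
      (Complex.exp (Real.pi * Complex.I * (y ^ 2 / u)))⁻¹ := by
    rw [← Complex.exp_neg]; congr 1; ring
  rw [this, jacobiTheta₂_inversion y hu]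
  have h2 := Complex.exp_ne_zero (Real.pi * Complex.I * (y ^ 2 / u))
  field_simp
  ring

theorem thetaDeriv_inversion (z α : ℂ) (τ τ' : ℍ) (hτ' : (τ' : ℂ) = -1 / τ) {u : ℂ}
    (hu : 0 < u.im) :
    thetaDeriv (z / τ) (α * τ - z) τ' (-1 / u) =
      -Complex.I * Complex.exp (Real.pi * Complex.I * (z ^ 2 / τ)) * sqrtNegI u * u *
        thetaDeriv z α τ u := by
  have hu0 : u ≠ 0 := right_ne_zero_of_mul (neg_I_mul_ne_zero hu)
  have hτ0 : (τ : ℂ) ≠ 0 := τ.ne_zero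
  have hpi : (Real.pi : ℂ) ≠ 0 := by exact_mod_cast Real.pi_ne_zero
  have hu' : 0 < (-1 / u).im := by
    rw [div_eq_mul_inv, neg_one_mul, Complex.neg_im, Complex.inv_im, neg_div, neg_neg]
    exact div_pos hu (Complex.normSq_pos.2 hu0)
  -- Inversion produces the shift -1/2; it differs from the +1/2 of `thetaDeriv_eq` by the period 1.
  set y := z + (u - τ) * α + u / 2 - 1 / 2 with hy
  have e1 : z / τ + (-1 / u - τ') * (α * τ - z) + -1 / u / 2 + 1 / 2 = y / u := by
    rw [hτ', hy]; field_simp; ring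
  have e2 : z + (u - τ) * α + u / 2 + 1 / 2 = y + 1 := by rw [hy]; ring
  rw [thetaDeriv_eq _ _ _ hu, thetaDeriv_eq _ _ _ hu', e1, e2, jacobiTheta₂_inversion y hu,
    jacobiTheta₂'_inversion y hu, jacobiTheta₂_add_left, jacobiTheta₂'_add_left]
  have e3 : Complex.exp (Real.pi * Complex.I * (-1 / u / 4 + (z / τ + (-1 / u - τ') * (α * τ - z)) +
        (-1 / u - τ') * (α * τ - z) ^ 2)) * Complex.exp (Real.pi * Complex.I * (y ^ 2 / u)) =
      -Complex.I * Complex.exp (Real.pi * Complex.I * (z ^ 2 / τ)) *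
      Complex.exp (Real.pi * Complex.I * (u / 4 + (z + (u - τ) * α) + (u - τ) * α ^ 2)) := by
    have : -Complex.I = Complex.exp (-(Real.pi / 2) * Complex.I) := by
      rw [neg_mul, Complex.exp_neg, Complex.exp_pi_div_two_mul_I, Complex.inv_I]
    rw [this, ← Complex.exp_add, ← Complex.exp_add, ← Complex.exp_add]
    congr 1
    rw [hτ', hy]
    field_simp
    ring
  -- The anomalous term 2πiy·θ in the inversion of the derivative combines with the linear factor to
  -- give u(1/2 + α), so Θ transforms with no correction term.
  have e4 : 1 / 2 + (α * τ - z) + y = u * (1 / 2 + α) := by rw [hy]; ring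
  have e5 : 2 * Real.pi * Complex.I * y / (2 * Real.pi * Complex.I) = y := by field_simp
  set A := jacobiTheta₂ y u
  set B := jacobiTheta₂' y u
  calc _ = (Complex.exp (Real.pi * Complex.I * (-1 / u / 4 +
        (z / τ + (-1 / u - τ') * (α * τ - z)) + (-1 / u - τ') * (α * τ - z) ^ 2)) *
        Complex.exp (Real.pi * Complex.I * (y ^ 2 / u))) * sqrtNegI u *
        ((1 / 2 + (α * τ - z) + y) * A + u * (B / (2 * Real.pi * Complex.I))) := by
        field_simp
        ring
    _ = _ := by rw [e3, e4]; ring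

theorem jacobiTheta_inversion (z : ℂ) (τ τ' : ℍ) (hτ' : (τ' : ℂ) = -1 / τ) :
    jacobiTheta (z / τ) τ' =
      -Complex.I * sqrtNegI τ * Complex.exp (Real.pi * Complex.I * (z ^ 2 / τ)) *
        jacobiTheta z τ := by
  have hτ0 : (τ : ℂ) ≠ 0 := τ.ne_zero
  rw [jacobiTheta_eq, jacobiTheta_eq, hτ']
  set y := z + τ / 2 - 1 / 2 with hy
  have e1 : z / τ + 1 / 2 + -1 / (τ : ℂ) / 2 = y / τ := by rw [hy]; field_simp; ring
  have e2 : z + 1 / 2 + (τ : ℂ) / 2 = y + 1 := by rw [hy]; ring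
  rw [e1, e2, jacobiTheta₂_inversion y τ.im_pos, jacobiTheta₂_add_left]
  have e3 : Complex.exp (Real.pi * Complex.I * (z / τ) + Real.pi * Complex.I * (-1 / τ) / 4) *
      Complex.exp (Real.pi * Complex.I * (y ^ 2 / τ)) =
      -Complex.I * Complex.exp (Real.pi * Complex.I * (z ^ 2 / τ)) *
      Complex.exp (Real.pi * Complex.I * z + Real.pi * Complex.I * τ / 4) := by
    have : -Complex.I = Complex.exp (-(Real.pi / 2) * Complex.I) := by
      rw [neg_mul, Complex.exp_neg, Complex.exp_pi_div_two_mul_I, Complex.inv_I]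
    rw [this, ← Complex.exp_add, ← Complex.exp_add, ← Complex.exp_add]
    congr 1
    rw [hy]
    field_simp
    ring
  linear_combination Complex.I * sqrtNegI τ * jacobiTheta₂ y τ * e3

/-- The equation makes (w-τ)D² constant, and it vanishes at w = τ. In other words, the nonzero
homogeneous solutions, multiples of (w-τ)^(-1/2), are singular at τ. At w = τ itself the equation
reads D = 0. -/
theorem eq_zero_of_ode {D : ℂ → ℂ} {τ : ℂ} (hτ : 0 < τ.im)
    (hD : ∀ w : ℂ, 0 < w.im → DifferentiableAt ℂ D w)
    (h : ∀ w : ℂ, 0 < w.im → 2 * (w - τ) * deriv D w + D w = 0) {w : ℂ} (hw : 0 < w.im) :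
    D w = 0 := by
  have hder (v : ℂ) (hv : 0 < v.im) : HasDerivAt (fun v => (v - τ) * D v ^ 2)
      (1 * D v ^ 2 + (v - τ) * ((2 : ℕ) * D v ^ (2 - 1) * deriv D v)) v :=
    ((hasDerivAt_id v).sub_const τ).mul ((hD v hv).hasDerivAt.pow 2)
  have hc := (isOpen_lt continuous_const Complex.continuous_im).is_const_of_deriv_eq_zero
    (convex_halfSpace_im_gt 0).isPreconnected (f := fun v => (v - τ) * D v ^ 2)
    (fun v hv => (hder v hv).differentiableAt.differentiableWithinAt)
    (fun v hv => by
      rw [(hder v hv).deriv]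
      simp only [Nat.cast_ofNat, Nat.add_one_sub_one, pow_one, Pi.zero_apply]
      linear_combination D v * h v hv) (x := w) (y := τ) hw hτ
  by_cases hwτ : w = τ
  · subst hwτ; simpa using h w hw
  · simp only [sub_self, zero_mul, mul_eq_zero, sub_eq_zero, hwτ, false_or] at hc
    exact pow_eq_zero_iff two_ne_zero |>.1 hc

theorem errSum_inversion (z α : ℂ) (τ τ' : ℍ) (hτ' : (τ' : ℂ) = -1 / τ) {w : ℂ} (hw : 0 < w.im) :
    errSum (z / τ) (α * τ - z) τ' (-1 / w) =
      -Complex.I * Complex.exp (Real.pi * Complex.I * (z ^ 2 / τ)) * τ * sqrtNegI w *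
        errSum z α τ w := by
  have hτ0 : (τ : ℂ) ≠ 0 := τ.ne_zero
  set g := errSum (z / τ) (α * τ - z) τ' with hg
  set c := -Complex.I * Complex.exp (Real.pi * Complex.I * (z ^ 2 / τ)) with hc
  have hne (v : ℂ) (hv : 0 < v.im) : v ≠ 0 := right_ne_zero_of_mul (neg_I_mul_ne_zero hv)
  have him (v : ℂ) (hv : 0 < v.im) : 0 < (-1 / v).im := by
    rw [div_eq_mul_inv, neg_one_mul, Complex.neg_im, Complex.inv_im, neg_div, neg_neg]
    exact div_pos hv (Complex.normSq_pos.2 (hne v hv))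
  have hdg (v : ℂ) (hv : 0 < v.im) : HasDerivAt (fun v => g (-1 / v))
      (deriv g (-1 / v) * (1 / v ^ 2)) v := by
    have h1 : HasDerivAt (fun v : ℂ => -1 / v) (1 / v ^ 2) v := by
      have := (hasDerivAt_inv (hne v hv)).const_mul (-1)
      simp only [div_eq_mul_inv]
      exact this.congr_deriv (by ring)
    exact (errSum_ode (z / τ) (α * τ - z) τ' (him v hv)).1.hasDerivAt.comp v h1
  have hdD (v : ℂ) (hv : 0 < v.im) := ((hdg v hv).div (hasDerivAt_sqrtNegI hv)
    (sqrtNegI_ne_zero hv)).sub ((errSum_ode z α τ hv).1.hasDerivAt.const_mul (c * τ))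
  have hz := eq_zero_of_ode (D := fun v => g (-1 / v) / sqrtNegI v - c * τ * errSum z α τ v)
    τ.im_pos (fun v hv => (hdD v hv).differentiableAt) (fun v hv => ?_) hw
  · rw [sub_eq_zero, div_eq_iff (sqrtNegI_ne_zero hw)] at hz
    rw [hz]; ring
  · have h1 : deriv (fun v => g (-1 / v) / sqrtNegI v - c * τ * errSum z α τ v) v = _ :=
      (hdD v hv).deriv
    have h2 := (errSum_ode (z / τ) (α * τ - z) τ' (him v hv)).2
    have h3 := (errSum_ode z α τ hv).2
    rw [thetaDeriv_inversion z α τ τ' hτ' hv, ← hc, ← hg, hτ', ← h3] at h2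
    have hκ := sqrtNegI_ne_zero hv
    have hv0 := hne v hv
    rw [h1]
    have h4 : 2 * (v - τ) * deriv g (-1 / v) + v * τ * g (-1 / v) =
        v * τ * (c * sqrtNegI v * v * (2 * (v - τ) * deriv (errSum z α τ) v + errSum z α τ v)) := by
      rw [← h2]; field_simp; ring
    -- Differentiating 1/√(-iv) contributes -(v-τ)/v, and 1 - (v-τ)/v = τ/v is the coefficient that
    -- the equation at -1/v supplies.
    have h5 : 2 * (v - τ) * ((deriv g (-1 / v) * (1 / v ^ 2) * sqrtNegI v -
        g (-1 / v) * (sqrtNegI v / (2 * v))) / sqrtNegI v ^ 2) + g (-1 / v) / sqrtNegI v =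
        (2 * (v - τ) * deriv g (-1 / v) + v * τ * g (-1 / v)) / (v ^ 2 * sqrtNegI v) := by
      field_simp; ring
    rw [h4] at h5
    have h6 : v * τ * (c * sqrtNegI v * v * (2 * (v - τ) * deriv (errSum z α τ) v +
        errSum z α τ v)) / (v ^ 2 * sqrtNegI v) =
        τ * c * (2 * (v - τ) * deriv (errSum z α τ) v + errSum z α τ v) := by
      field_simp
    rw [h6] at h5
    linear_combination h5

/-! ### Transformation laws under SL₂(ℤ) -/

theorem cocycle_ne_zero (γ : SL(2, ℤ)) (τ : ℍ) : cocycle γ τ ≠ 0 := by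
  have := UpperHalfPlane.denom_ne_zero (γ : GL (Fin 2) ℝ) τ
  rwa [ModularGroup.denom_apply] at this

theorem coe_smul_eq (γ : SL(2, ℤ)) (τ : ℍ) :
    ((γ • τ : ℍ) : ℂ) = (((γ 0 0 : ℤ) : ℂ) * τ + ((γ 0 1 : ℤ) : ℂ)) / cocycle γ τ := by
  rw [UpperHalfPlane.coe_specialLinearGroup_apply]
  simp [cocycle]

theorem det_eq_one (γ : SL(2, ℤ)) :
    ((γ 0 0 : ℤ) : ℂ) * ((γ 1 1 : ℤ) : ℂ) - ((γ 0 1 : ℤ) : ℂ) * ((γ 1 0 : ℤ) : ℂ) = 1 := by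
  have := γ.det_coe
  rw [Matrix.det_fin_two] at this
  exact_mod_cast this

theorem cocycle_mul (γ δ : SL(2, ℤ)) (τ : ℍ) :
    cocycle (γ * δ) τ = cocycle γ (δ • τ) * cocycle δ τ := by
  have h := cocycle_ne_zero δ τ
  rw [cocycle, cocycle, coe_smul_eq, Matrix.SpecialLinearGroup.coe_mul, Matrix.mul_apply,
    Matrix.mul_apply]
  simp only [Fin.sum_univ_two]
  field_simp
  push_cast
  rw [cocycle]
  ring

theorem cocycle_one (τ : ℍ) : cocycle 1 τ = 1 := by simp [cocycle]

theorem cocycle_inv (γ : SL(2, ℤ)) (τ : ℍ) :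
    cocycle γ (γ⁻¹ • τ) * cocycle γ⁻¹ τ = 1 := by
  rw [← cocycle_mul, mul_inv_cancel, cocycle_one]

theorem smul_sub_smul (γ : SL(2, ℤ)) (τ w : ℍ) :
    ((γ • w : ℍ) : ℂ) - ((γ • τ : ℍ) : ℂ) = ((w : ℂ) - τ) / (cocycle γ τ * cocycle γ w) := by
  have h1 := cocycle_ne_zero γ τ
  have h2 := cocycle_ne_zero γ w
  rw [coe_smul_eq, coe_smul_eq, div_sub_div _ _ h2 h1, mul_comm (cocycle γ τ)]
  congr 1
  rw [cocycle, cocycle]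
  linear_combination ((w : ℂ) - τ) * det_eq_one γ

/-- This is the identity that makes cz²/(cτ+d) additive under composition, hence `indexFactor`
multiplicative. -/
theorem lower_left_mul (γ δ : SL(2, ℤ)) (τ : ℍ) :
    (((γ * δ) 1 0 : ℤ) : ℂ) * cocycle δ τ =
      ((γ 1 0 : ℤ) : ℂ) + ((δ 1 0 : ℤ) : ℂ) * cocycle (γ * δ) τ := by
  rw [cocycle, cocycle, Matrix.SpecialLinearGroup.coe_mul, Matrix.mul_apply, Matrix.mul_apply]
  simp only [Fin.sum_univ_two]
  push_cast
  linear_combination ((γ 1 0 : ℤ) : ℂ) * det_eq_one δ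

theorem continuous_sl2_smul (γ : SL(2, ℤ)) : Continuous fun τ : ℍ => γ • τ :=
  continuous_const_smul (γ : GL (Fin 2) ℝ)

/-- The series `errSum` at the real point `α = Im z / Im τ`. -/
def errReal (z : ℂ) (τ w : ℍ) : ℂ := errSum z ((z.im / τ.im : ℝ) : ℂ) τ w

/-- The exponential factor `exp (πi c z² / (cτ + d))` of index `1/2`. -/
def indexFactor (γ : SL(2, ℤ)) (z : ℂ) (τ : ℍ) : ℂ :=
  Complex.exp (Real.pi * Complex.I * (((γ 1 0 : ℤ) : ℂ) * z ^ 2 / cocycle γ τ))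

theorem indexFactor_mul (γ δ : SL(2, ℤ)) (z : ℂ) (τ : ℍ) :
    indexFactor (γ * δ) z τ = indexFactor γ (z / cocycle δ τ) (δ • τ) * indexFactor δ z τ := by
  have h1 := cocycle_ne_zero γ (δ • τ)
  have h2 := cocycle_ne_zero δ τ
  have h3 := lower_left_mul γ δ τ
  rw [indexFactor, indexFactor, indexFactor, ← Complex.exp_add]
  congr 1
  rw [cocycle_mul] at h3 ⊢
  field_simp
  linear_combination z ^ 2 * h3

theorem indexFactor_one (z : ℂ) (τ : ℍ) : indexFactor 1 z τ = 1 := by simp [indexFactor]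

theorem indexFactor_ne_zero (γ : SL(2, ℤ)) (z : ℂ) (τ : ℍ) : indexFactor γ z τ ≠ 0 :=
  Complex.exp_ne_zero _

/-- `γ` acts on the theta function and on its error series by automorphy factors that involve
the same continuous square root `m` of the cocycle. -/
def IsModularAt (γ : SL(2, ℤ)) : Prop :=
  ∃ m C : ℍ → ℂ, Continuous m ∧ (∀ τ, m τ ^ 2 = cocycle γ τ) ∧ (∀ τ, C τ ≠ 0) ∧
    (∀ z τ, jacobiTheta (z / cocycle γ τ) (γ • τ) =
      C τ * indexFactor γ z τ * jacobiTheta z τ) ∧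
    (∀ z τ w, errReal (z / cocycle γ τ) (γ • τ) (γ • w) =
      C τ * indexFactor γ z τ * (m τ * m w) * errReal z τ w)

theorem isModularAt_one : IsModularAt 1 :=
  ⟨fun _ => 1, fun _ => 1, continuous_const, by simp [cocycle_one], by simp,
    by simp [cocycle_one, indexFactor_one], by simp [cocycle_one, indexFactor_one]⟩

theorem IsModularAt.mul {γ δ : SL(2, ℤ)} (hγ : IsModularAt γ) (hδ : IsModularAt δ) :
    IsModularAt (γ * δ) := by
  obtain ⟨m, C, hm, hm2, hC, hJ, hE⟩ := hγ
  obtain ⟨m', C', hm', hm2', hC', hJ', hE'⟩ := hδ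
  refine ⟨fun τ => m (δ • τ) * m' τ, fun τ => C (δ • τ) * C' τ,
    (hm.comp (continuous_sl2_smul δ)).mul hm', fun τ => ?_, fun τ => mul_ne_zero (hC _) (hC' _),
    fun z τ => ?_, fun z τ w => ?_⟩
  · rw [mul_pow, hm2, hm2', cocycle_mul]
  · rw [cocycle_mul, mul_comm (cocycle γ _), ← div_div, mul_smul, hJ, hJ', indexFactor_mul]
    ring
  · rw [cocycle_mul, mul_comm (cocycle γ _), ← div_div, mul_smul, mul_smul, hE, hE',
      indexFactor_mul]
    ring

theorem IsModularAt.inv {γ : SL(2, ℤ)} (hγ : IsModularAt γ) : IsModularAt γ⁻¹ := by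
  obtain ⟨m, C, hm, hm2, hC, hJ, hE⟩ := hγ
  have hm0 (τ : ℍ) : m τ ≠ 0 := by
    intro h
    have := hm2 τ
    rw [h] at this
    exact cocycle_ne_zero γ τ (by simpa using this.symm)
  have hi (z : ℂ) (τ : ℍ) :
      indexFactor γ (z / cocycle γ⁻¹ τ) (γ⁻¹ • τ) * indexFactor γ⁻¹ z τ = 1 := by
    rw [← indexFactor_mul, mul_inv_cancel, indexFactor_one]
  have hz (z : ℂ) (τ : ℍ) : z / cocycle γ⁻¹ τ / cocycle γ (γ⁻¹ • τ) = z := by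
    rw [div_div, mul_comm (cocycle γ⁻¹ τ), cocycle_inv, div_one]
  refine ⟨fun τ => (m (γ⁻¹ • τ))⁻¹, fun τ => (C (γ⁻¹ • τ))⁻¹,
    (hm.comp (continuous_sl2_smul _)).inv₀ fun τ => hm0 _, fun τ => ?_,
    fun τ => inv_ne_zero (hC _), fun z τ => ?_, fun z τ w => ?_⟩
  · rw [inv_pow, hm2]
    exact inv_eq_of_mul_eq_one_right (cocycle_inv γ τ)
  · have h := hJ (z / cocycle γ⁻¹ τ) (γ⁻¹ • τ)
    rw [hz, smul_inv_smul] at h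
    rw [h]
    have := hC (γ⁻¹ • τ)
    field_simp
    linear_combination (-jacobiTheta (z / cocycle γ⁻¹ τ) (γ⁻¹ • τ)) * hi z τ
  · have h := hE (z / cocycle γ⁻¹ τ) (γ⁻¹ • τ) (γ⁻¹ • w)
    rw [hz, smul_inv_smul, smul_inv_smul] at h
    rw [h]
    have := hC (γ⁻¹ • τ)
    have := hm0 (γ⁻¹ • τ)
    have := hm0 (γ⁻¹ • w)
    field_simp
    linear_combination (-errReal (z / cocycle γ⁻¹ τ) (γ⁻¹ • τ) (γ⁻¹ • w)) * hi z τ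

theorem cocycle_S (τ : ℍ) : cocycle ModularGroup.S τ = τ := by simp [cocycle, ModularGroup.S]

theorem cocycle_T (τ : ℍ) : cocycle ModularGroup.T τ = 1 := by simp [cocycle, ModularGroup.T]

theorem coe_S_smul (τ : ℍ) : ((ModularGroup.S • τ : ℍ) : ℂ) = -1 / τ := by
  rw [coe_smul_eq, cocycle_S]; simp [ModularGroup.S]

theorem coe_T_smul (τ : ℍ) : ((ModularGroup.T • τ : ℍ) : ℂ) = τ + 1 := by
  rw [coe_smul_eq, cocycle_T]; simp [ModularGroup.T]

theorem thetaTerm_T (n : ℤ) (z : ℂ) (τ : ℍ) :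
    thetaTerm n z (ModularGroup.T • τ) =
      Complex.exp (Real.pi * Complex.I / 4) * thetaTerm n z τ := by
  have h1 : Complex.exp (Real.pi * Complex.I * ((n : ℂ) ^ 2 + n)) = 1 := by
    obtain ⟨k, hk⟩ := Int.even_mul_succ_self n
    have : ((n : ℂ) ^ 2 + n) = k + k := by
      have : n ^ 2 + n = k + k := by rw [← hk]; ring
      exact_mod_cast this
    rw [this, Complex.exp_eq_one_iff]
    exact ⟨k, by ring⟩
  have h2 : Complex.exp (Real.pi * Complex.I * ((n : ℂ) + 1 / 2) ^ 2 * ((τ : ℂ) + 1)) =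
      Complex.exp (Real.pi * Complex.I / 4) *
        Complex.exp (Real.pi * Complex.I * ((n : ℂ) + 1 / 2) ^ 2 * (τ : ℂ)) := by
    have : Real.pi * Complex.I * ((n : ℂ) + 1 / 2) ^ 2 * ((τ : ℂ) + 1) =
        Real.pi * Complex.I / 4 + Real.pi * Complex.I * ((n : ℂ) ^ 2 + n) +
          Real.pi * Complex.I * ((n : ℂ) + 1 / 2) ^ 2 * (τ : ℂ) := by ring
    rw [this, Complex.exp_add, Complex.exp_add, h1, mul_one]
  rw [thetaTerm, thetaTerm, coe_T_smul, h2]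
  ring

theorem im_T_smul (τ : ℍ) : (ModularGroup.T • τ : ℍ).im = τ.im := by
  rw [← UpperHalfPlane.coe_im, coe_T_smul]; simp

theorem isModularAt_T : IsModularAt ModularGroup.T := by
  have hi (z : ℂ) (τ : ℍ) : indexFactor ModularGroup.T z τ = 1 := by
    simp [indexFactor, ModularGroup.T]
  refine ⟨fun _ => 1, fun _ => Complex.exp (Real.pi * Complex.I / 4), continuous_const,
    by simp [cocycle_T], fun _ => Complex.exp_ne_zero _, fun z τ => ?_, fun z τ w => ?_⟩
  · rw [cocycle_T, hi, div_one, jacobiTheta, jacobiTheta]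
    simp only [thetaTerm_T, tsum_mul_left]
    ring
  · rw [cocycle_T, hi, div_one, errReal, errReal, errSum, errSum, mul_one, mul_one, mul_one,
      ← tsum_mul_left]
    refine tsum_congr fun n => ?_
    rw [errTerm, errTerm, thetaTerm_T, coe_T_smul, coe_T_smul, im_T_smul, add_sub_add_right_eq_sub]
    ring

/-- Write z = ατ + β with α, β real. Then z/τ = (-β)(-1/τ) + α, so the new real coordinate is -β =
ατ - z. This matches the shift of α in `errSum_inversion`. -/
theorem im_div_im_S (z : ℂ) (τ : ℍ) :
    (((z / τ).im / (ModularGroup.S • τ : ℍ).im : ℝ) : ℂ) =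
      ((z.im / τ.im : ℝ) : ℂ) * τ - z := by
  have h0 : (τ : ℂ) ≠ 0 := τ.ne_zero
  have h1 : Complex.normSq (τ : ℂ) ≠ 0 := by simpa using h0
  have h2 : τ.im ≠ 0 := τ.im_ne_zero
  have h3 : (ModularGroup.S • τ : ℍ).im = τ.im / Complex.normSq (τ : ℂ) := by
    rw [← UpperHalfPlane.coe_im, coe_S_smul, div_eq_mul_inv, neg_one_mul, Complex.neg_im,
      Complex.inv_im, neg_div, neg_neg, UpperHalfPlane.coe_im]
  rw [h3, Complex.div_im]
  apply Complex.ext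
  · rw [Complex.ofReal_re, Complex.sub_re, Complex.re_ofReal_mul]
    simp only [UpperHalfPlane.coe_im, UpperHalfPlane.coe_re]
    field_simp
  · rw [Complex.ofReal_im, Complex.sub_im, Complex.im_ofReal_mul, UpperHalfPlane.coe_im]
    field_simp
    simp

theorem isModularAt_S : IsModularAt ModularGroup.S := by
  have hi (z : ℂ) (τ : ℍ) : indexFactor ModularGroup.S z τ =
      Complex.exp (Real.pi * Complex.I * (z ^ 2 / τ)) := by
    rw [indexFactor, cocycle_S]
    simp [ModularGroup.S]
  -- As ζ² = i, the function ζ√(-iτ) is a continuous square root of the cocycle τ.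
  set ζ := Complex.exp (Real.pi / 4 * Complex.I) with hζ
  have hζ2 : ζ ^ 2 = Complex.I := by
    have : (2 : ℕ) * (Real.pi / 4 * Complex.I : ℂ) = Real.pi / 2 * Complex.I := by
      push_cast; ring
    rw [hζ, ← Complex.exp_nat_mul, this, Complex.exp_pi_div_two_mul_I]
  refine ⟨fun τ => ζ * sqrtNegI τ, fun τ => -Complex.I * sqrtNegI τ, ?_, fun τ => ?_,
    fun τ => mul_ne_zero (by simp) (sqrtNegI_ne_zero τ.im_pos), fun z τ => ?_, fun z τ w => ?_⟩
  · refine continuous_const.mul (continuous_iff_continuousAt.2 fun τ => ?_)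
    exact (hasDerivAt_sqrtNegI τ.im_pos).continuousAt.comp
      UpperHalfPlane.continuous_coe.continuousAt
  · rw [mul_pow, hζ2, sqrtNegI_sq, cocycle_S]
    linear_combination (-(τ : ℂ)) * Complex.I_sq
  · rw [cocycle_S, hi, jacobiTheta_inversion z τ _ (coe_S_smul τ)]
  · have h := errSum_inversion z ((z.im / τ.im : ℝ) : ℂ) τ _ (coe_S_smul τ) w.im_pos
    rw [← im_div_im_S, ← coe_S_smul w] at h
    rw [cocycle_S, hi, errReal, errReal, h]
    have h1 := sqrtNegI_sq τ
    linear_combination (Complex.I * Complex.exp (Real.pi * Complex.I * (z ^ 2 / τ)) * sqrtNegI w *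
      errSum z ((z.im / τ.im : ℝ) : ℂ) τ w) * (ζ ^ 2 * h1 - Complex.I * τ * hζ2 - τ * Complex.I_sq)

theorem isModularAt (γ : SL(2, ℤ)) : IsModularAt γ := by
  have h : γ ∈ Subgroup.closure {ModularGroup.S, ModularGroup.T} := by
    rw [SpecialLinearGroup.SL2Z_generators]; trivial
  induction h using Subgroup.closure_induction with
  | mem x hx =>
    rcases hx with rfl | rfl
    exacts [isModularAt_S, isModularAt_T]
  | one => exact isModularAt_one
  | mul x y _ _ hx hy => exact hx.mul hy
  | inv x _ hx => exact hx.inv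

/-! ### Principal square roots and the sign χ -/

theorem sqrt_sq (z : ℂ) : Complex.sqrt z ^ 2 = z := Complex.cpow_nat_inv_pow _ two_ne_zero

theorem sqrt_ne_zero {z : ℂ} (hz : z ≠ 0) : Complex.sqrt z ≠ 0 := fun h =>
  hz (by rw [← sqrt_sq z, h]; simp)

theorem sqrt_ofReal_mul {r : ℝ} (hr : 0 < r) {z : ℂ} (hz : z ≠ 0) :
    Complex.sqrt (r * z) = Complex.sqrt r * Complex.sqrt z := by
  have hr0 : (r : ℂ) ≠ 0 := by exact_mod_cast hr.ne'
  rw [sqrt_eq_exp (mul_ne_zero hr0 hz), sqrt_eq_exp hr0, sqrt_eq_exp hz,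
    Complex.log_ofReal_mul hr hz, ← Complex.exp_add, add_div, Complex.ofReal_log hr.le]

theorem continuous_cocycle (γ : SL(2, ℤ)) : Continuous (cocycle γ) := by
  have := UpperHalfPlane.continuous_coe
  unfold cocycle
  fun_prop

theorem continuous_sqrt_cocycle (γ : SL(2, ℤ)) :
    Continuous fun τ : ℍ => Complex.sqrt (cocycle γ τ) := by
  by_cases hc : γ 1 0 = 0
  · simp [cocycle, hc, continuous_const]
  · rw [continuous_iff_continuousAt]
    intro τ
    refine ContinuousAt.comp (f := cocycle γ) (g := Complex.sqrt) (Complex.continuousAt_sqrt ?_)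
      (continuous_cocycle γ).continuousAt
    right
    simp [cocycle, hc, τ.im_ne_zero]

/-- The principal root of cτ+d is continuous on the upper half-plane. By connectedness `m` is that
root up to one global sign, which cancels in the product. -/
theorem mul_eq_sqrt_mul_sqrt {γ : SL(2, ℤ)} {m : ℍ → ℂ} (hm : Continuous m)
    (hm2 : ∀ τ, m τ ^ 2 = cocycle γ τ) (τ w : ℍ) :
    m τ * m w = Complex.sqrt (cocycle γ τ) * Complex.sqrt (cocycle γ w) := by
  rcases isPreconnected_univ.eq_or_eq_neg_of_sq_eq hm.continuousOn
    (continuous_sqrt_cocycle γ).continuousOn (fun τ _ => by simp [hm2, sqrt_sq])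
    (fun {τ} _ => sqrt_ne_zero (cocycle_ne_zero γ τ)) with h | h
  · rw [h (Set.mem_univ τ), h (Set.mem_univ w)]
  · rw [h (Set.mem_univ τ), h (Set.mem_univ w)]
    simp

theorem I_mul_sub_ne_zero {τ w : ℍ} (h : τ ≠ w) : Complex.I * ((w : ℂ) - τ) ≠ 0 := by
  refine mul_ne_zero Complex.I_ne_zero (sub_ne_zero.2 fun h2 => h ?_)
  exact (UpperHalfPlane.ext h2).symm

theorem chi_sq (γ : SL(2, ℤ)) {τ w : ℍ} (h : τ ≠ w) : chi γ τ w ^ 2 = 1 := by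
  have h1 := I_mul_sub_ne_zero h
  have h2 := cocycle_ne_zero γ τ
  have h3 := cocycle_ne_zero γ w
  rw [chi, mul_pow, div_pow, mul_pow, sqrt_sq, sqrt_sq, sqrt_sq, sqrt_sq, ← mul_div_assoc,
    div_mul_cancel₀ _ (mul_ne_zero h2 h3), div_self h1]

theorem chi_mul_sqrt (γ : SL(2, ℤ)) {τ w : ℍ} (h : τ ≠ w) :
    Complex.sqrt (Complex.I * (((γ • w : ℍ) : ℂ) - ((γ • τ : ℍ) : ℂ))) *
      (Complex.sqrt (cocycle γ τ) * Complex.sqrt (cocycle γ w)) =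
    chi γ τ w * Complex.sqrt (Complex.I * ((w : ℂ) - τ)) := by
  have h1 := sqrt_ne_zero (I_mul_sub_ne_zero h)
  rw [chi, smul_sub_smul, ← mul_div_assoc]
  field_simp

theorem thetaTerm_neg (n : ℤ) (z : ℂ) (τ : ℍ) :
    thetaTerm (-1 - n) (-z) τ = -thetaTerm n z τ := by
  have h1 : (-1 : ℂ) ^ (-1 - n) = -(-1) ^ n := by
    rw [sub_eq_add_neg, zpow_add₀ (by norm_num), zpow_neg, zpow_neg, zpow_one, ← inv_zpow, inv_neg_one]
    ring
  have h2 : (((-1 - n : ℤ) : ℂ) + 1 / 2) = -((n : ℂ) + 1 / 2) := by push_cast; ring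
  rw [thetaTerm, thetaTerm, h1, h2, neg_sq]
  ring_nf

theorem jacobiTheta_neg (z : ℂ) (τ : ℍ) : jacobiTheta (-z) τ = -jacobiTheta z τ := by
  rw [jacobiTheta, jacobiTheta, ← (Equiv.subLeft (-1 : ℤ)).tsum_eq, ← mul_neg, ← tsum_neg]
  simp only [Equiv.subLeft_apply, thetaTerm_neg]

theorem errTerm_neg (n : ℤ) (z α : ℂ) (τ : ℍ) (w : ℂ) :
    errTerm (-1 - n) (-z) (-α) τ w = errTerm n z α τ w := by
  have h2 : (((-1 - n : ℤ) : ℂ) + 1 / 2 + -α) = -((n : ℂ) + 1 / 2 + α) := by push_cast; ring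
  rw [errTerm, errTerm, thetaTerm_neg, h2, neg_sq]
  ring

theorem errReal_neg (z : ℂ) (τ w : ℍ) : errReal (-z) τ w = errReal z τ w := by
  rw [errReal, errReal, Complex.neg_im, neg_div, Complex.ofReal_neg, errSum, errSum,
    ← (Equiv.subLeft (-1 : ℤ)).tsum_eq]
  simp only [Equiv.subLeft_apply, errTerm_neg]

/-- The factor relating `psiHat` to `errSum`. -/
def psiFactor (τ w : ℍ) : ℂ :=
  Complex.I * (2 / (Real.sqrt Real.pi : ℂ) *
    (-Complex.I * Complex.sqrt (Real.pi * Complex.I * ((w : ℂ) - (τ : ℂ)))))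

theorem psiHat_eq (z : ℂ) (τ w : ℍ) : psiHat z τ w = psiFactor τ w * errReal z τ w := by
  rw [psiHat_eq_errSum, psiFactor, errReal]; ring

theorem psiFactor_smul (γ : SL(2, ℤ)) {τ w : ℍ} (h : τ ≠ w) :
    psiFactor (γ • τ) (γ • w) * (Complex.sqrt (cocycle γ τ) * Complex.sqrt (cocycle γ w)) =
      chi γ τ w * psiFactor τ w := by
  have h' : γ • τ ≠ γ • w := fun h2 => h (smul_left_cancel γ h2)
  rw [psiFactor, psiFactor, mul_assoc (Real.pi : ℂ), mul_assoc (Real.pi : ℂ),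
    sqrt_ofReal_mul Real.pi_pos (I_mul_sub_ne_zero h),
    sqrt_ofReal_mul Real.pi_pos (I_mul_sub_ne_zero h')]
  linear_combination (Complex.I * (2 / (Real.sqrt Real.pi : ℂ) *
    (-Complex.I * Complex.sqrt Real.pi))) * chi_mul_sqrt γ h

/-- For χ = -1 the transformed function is ϑ - ψ̂, and parity turns it into -T̂(-z); this is how the
sign moves from ψ̂ to the argument. -/
theorem THat_smul (γ : SL(2, ℤ)) {τ w : ℍ} (h : τ ≠ w) :
    ∃ C : ℂ, C ≠ 0 ∧ ∀ z, THat (z / cocycle γ τ) (γ • τ) (γ • w) =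
      C * indexFactor γ z τ * THat (chi γ τ w * z) τ w := by
  obtain ⟨m, C, hm, hm2, hC, hJ, hE⟩ := isModularAt γ
  have hχ := chi_sq γ h
  have key (z : ℂ) : THat (z / cocycle γ τ) (γ • τ) (γ • w) =
      C τ * indexFactor γ z τ * (jacobiTheta z τ + chi γ τ w * psiHat z τ w) := by
    rw [THat, hJ, psiHat_eq, psiHat_eq, hE, mul_eq_sqrt_mul_sqrt hm hm2]
    linear_combination C τ * indexFactor γ z τ * errReal z τ w * psiFactor_smul γ h
  refine ⟨C τ * chi γ τ w, mul_ne_zero (hC τ) fun h0 => by simp [h0] at hχ, fun z => ?_⟩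
  rw [key]
  rcases sq_eq_sq_iff_eq_or_eq_neg.1 (hχ.trans (one_pow 2).symm) with h1 | h1
  · rw [h1, THat]; simp
  · rw [h1, THat, neg_one_mul z, jacobiTheta_neg, psiHat_eq, psiHat_eq, errReal_neg]
    ring

/-! ### Transformation of the Taylor coefficients -/

/-- The completed theta function with `z` and `z̄` treated as independent variables. -/
def THatPolar (τ w : ℍ) (z z' : ℂ) : ℂ :=
  jacobiTheta z τ + psiFactor τ w * errSum z ((z - z') / (2 * Complex.I * (τ.im : ℂ))) τ w

theorem THat_eq_polar (z : ℂ) (τ w : ℍ) :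
    THat z τ w = THatPolar τ w z (starRingEnd ℂ z) := by
  rw [THat, THatPolar, psiHat_eq, errReal]
  congr 3
  have h : (τ.im : ℂ) ≠ 0 := by exact_mod_cast τ.im_ne_zero
  rw [Complex.sub_conj]
  push_cast
  field_simp

theorem contDiff_THatPolar (τ w : ℍ) (k : ℕ) :
    ContDiff ℂ k fun p : ℂ × ℂ => THatPolar τ w p.1 p.2 := by
  have h1 := (separatelyEntire_errSum τ w.im_pos).contDiff k
  have h2 : ContDiff ℂ k fun z => jacobiTheta z τ := (differentiable_jacobiTheta τ).contDiff
  have h3 : ContDiff ℂ k fun p : ℂ × ℂ =>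
      (p.1, (p.1 - p.2) / (2 * Complex.I * (τ.im : ℂ))) := by fun_prop
  exact (h2.comp contDiff_fst).add (contDiff_const.mul (h1.comp h3))

theorem THatPolar_zero (τ w : ℍ) : THatPolar τ w 0 0 = THat 0 τ w := by
  rw [THat_eq_polar, map_zero]

/-- The scalings `a` and `b` are independent because the modular law multiplies z by a complex
number and z̄ by its conjugate, while the holomorphic slice has b = 0. -/
theorem contDiffAt_log_THatPolar {τ w : ℍ} (h : THat 0 τ w ≠ 0) (a b : ℂ) (k : ℕ) :
    ContDiffAt ℂ k
      (fun p : ℂ × ℂ => Complex.log (THatPolar τ w (a * p.1) (b * p.2) / THat 0 τ w)) (0, 0) := by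
  have h1 : ContDiff ℂ k fun p : ℂ × ℂ => (a * p.1, b * p.2) := by fun_prop
  have h2 : ContDiff ℂ k
      fun p : ℂ × ℂ => THatPolar τ w (a * p.1) (b * p.2) / THat 0 τ w :=
    ((contDiff_THatPolar τ w k).comp h1).div_const _
  refine ContDiffAt.comp (g := Complex.log)
    (f := fun p : ℂ × ℂ => THatPolar τ w (a * p.1) (b * p.2) / THat 0 τ w) (0, 0)
    (Complex.contDiffAt_log ?_) h2.contDiffAt
  simp [THatPolar_zero, h]

theorem gHatCoeff_eq {τ w : ℍ} (h : THat 0 τ w ≠ 0) (k : ℕ) :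
    gHatCoeff k τ w = -iteratedDeriv k
      (fun s => Complex.log (THatPolar τ w s 0 / THat 0 τ w)) 0 / (2 * Real.pi * Complex.I) ^ k := by
  rw [gHatCoeff]
  have h1 := wirtinger_iterate_comp_conj k (z := 0)
    (F := fun p : ℂ × ℂ => Complex.log (THatPolar τ w p.1 p.2 / THat 0 τ w))
    (by simpa using contDiffAt_log_THatPolar h 1 1 k)
  simp only [zero_add, map_zero, ← THat_eq_polar] at h1
  rw [h1]

theorem iteratedDeriv_comp_mul_left (k : ℕ) (f : ℂ → ℂ) (c x : ℂ) :
    iteratedDeriv k (fun y => f (c * y)) x = c ^ k * iteratedDeriv k f (c * x) := by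
  induction k generalizing x with
  | zero => simp
  | succ k ih =>
    rw [iteratedDeriv_succ, funext ih, iteratedDeriv_succ, deriv_const_mul_field,
      deriv_comp_mul_left c (iteratedDeriv k f) x, smul_eq_mul, pow_succ, mul_assoc]

theorem iteratedDeriv_const_mul_sq (k : ℕ) (B : ℂ) :
    iteratedDeriv k (fun s : ℂ => B * s ^ 2) 0 = if k = 2 then 2 * B else 0 := by
  have h1 : deriv (fun s : ℂ => B * s ^ 2) = fun s => 2 * B * s := by
    ext s
    simp; ring
  have h2 : deriv (fun s : ℂ => 2 * B * s) = fun _ => 2 * B := by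
    ext s
    simp
  match k with
  | 0 => simp
  | 1 => simp
  | k + 2 =>
    rw [iteratedDeriv_succ', iteratedDeriv_succ', h1, h2, iteratedDeriv_const]
    simp

theorem THat_zero_smul_ne_zero_iff (γ : SL(2, ℤ)) {τ w : ℍ} (h : τ ≠ w) :
    THat 0 (γ • τ) (γ • w) ≠ 0 ↔ THat 0 τ w ≠ 0 := by
  obtain ⟨C, hC, hT⟩ := THat_smul γ h
  have := hT 0
  rw [zero_div, mul_zero] at this
  rw [this]
  simp [hC, indexFactor_ne_zero]

/-- Near 0 the imaginary part of Q + log R stays in (-π, π), so no branch of the logarithm is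
crossed. -/
theorem eventually_log_exp_mul {Q R : ℂ → ℂ} (hQ : ContinuousAt Q 0) (hR : ContinuousAt R 0)
    (hQ0 : Q 0 = 0) (hR0 : R 0 = 1) :
    (fun z => Complex.log (Complex.exp (Q z) * R z)) =ᶠ[𝓝 0]
      fun z => Q z + Complex.log (R z) := by
  have h1 : ContinuousAt (fun z => (Q z + Complex.log (R z)).im) 0 :=
    Complex.continuous_im.continuousAt.comp (hQ.add (hR.clog (by simp [hR0])))
  have h2 : ∀ᶠ z in 𝓝 0, (Q z + Complex.log (R z)).im ∈ Set.Ioo (-Real.pi) Real.pi :=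
    h1.eventually (isOpen_Ioo.mem_nhds (by simp [hQ0, hR0, Real.pi_pos]))
  have h3 : ∀ᶠ z in 𝓝 0, R z ≠ 0 := hR.eventually_ne (by simp [hR0])
  filter_upwards [h2, h3] with z hz hz'
  conv_lhs => rw [← Complex.exp_log hz', ← Complex.exp_add]
  exact Complex.log_exp hz.1 hz.2.le

theorem gHatCoeff_smul (k : ℕ) (γ : SL(2, ℤ)) {τ w : ℍ} (h : τ ≠ w) (h0 : THat 0 τ w ≠ 0) :
    gHatCoeff k (γ • τ) (γ • w) =
      chi γ τ w ^ k * cocycle γ τ ^ k * gHatCoeff k τ w +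
        if k = 2 then Complex.I * ((γ 1 0 : ℤ) : ℂ) / (2 * Real.pi) * cocycle γ τ else 0 := by
  obtain ⟨C, hC, hT⟩ := THat_smul γ h
  have hj := cocycle_ne_zero γ τ
  have hpi : (Real.pi : ℂ) ≠ 0 := by exact_mod_cast Real.pi_ne_zero
  -- The index factor at (cτ+d)z is exp(Bz²). The coefficient -2B/(2πi)² equals ic(cτ+d)/(2π), the
  -- anomaly at k = 2.
  set B : ℂ := Real.pi * Complex.I * (((γ 1 0 : ℤ) : ℂ) * cocycle γ τ) with hB
  set l := chi γ τ w * cocycle γ τ with hl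
  have hT0 : THat 0 (γ • τ) (γ • w) = C * THat 0 τ w := by
    have := hT 0
    rw [zero_div, mul_zero] at this
    rw [this]
    simp [indexFactor]
  have hquot (z : ℂ) : THat z (γ • τ) (γ • w) / THat 0 (γ • τ) (γ • w) =
      Complex.exp (B * z ^ 2) * (THatPolar τ w (l * z) (starRingEnd ℂ l * starRingEnd ℂ z) /
        THat 0 τ w) := by
    have h1 := hT (cocycle γ τ * z)
    rw [mul_div_cancel_left₀ _ hj, ← mul_assoc, ← hl] at h1
    have h2 : indexFactor γ (cocycle γ τ * z) τ = Complex.exp (B * z ^ 2) := by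
      rw [indexFactor, hB]
      congr 1
      field_simp
    rw [h1, h2, hT0, THat_eq_polar, map_mul]
    field_simp
  have hcont : Continuous fun z : ℂ =>
      THatPolar τ w (l * z) (starRingEnd ℂ l * starRingEnd ℂ z) / THat 0 τ w := by
    have h1 := (contDiff_THatPolar τ w 0).continuous
    have h2 : Continuous fun z : ℂ => (l * z, starRingEnd ℂ l * starRingEnd ℂ z) :=
      (continuous_const.mul continuous_id).prodMk (continuous_const.mul Complex.continuous_conj)
    exact (h1.comp h2).div_const _
  have hev := eventually_log_exp_mul (Q := fun z => B * z ^ 2) (by fun_prop) hcont.continuousAt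
    (by simp) (by simp [THatPolar_zero, h0])
  have hq : ContDiff ℂ k fun p : ℂ × ℂ => B * p.1 ^ 2 := by fun_prop
  have hw := wirtinger_iterate_comp_conj k (z := 0) (F := fun p : ℂ × ℂ => B * p.1 ^ 2 +
    Complex.log (THatPolar τ w (l * p.1) (starRingEnd ℂ l * p.2) / THat 0 τ w))
    (by
      rw [map_zero]
      exact hq.contDiffAt.add (contDiffAt_log_THatPolar h0 l (starRingEnd ℂ l) k))
  have hs : ContDiffAt ℂ k (fun s : ℂ => Complex.log (THatPolar τ w (l * s) 0 / THat 0 τ w)) 0 := by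
    have h1 := contDiffAt_log_THatPolar h0 l 0 k
    have h2 : ContDiff ℂ k fun s : ℂ => (s, (0 : ℂ)) := by fun_prop
    simpa using! ContDiffAt.comp (f := fun s : ℂ => (s, (0 : ℂ))) 0 h1 h2.contDiffAt
  rw [gHatCoeff]
  simp only [hquot]
  -- On the slice z̄ = 0 the conjugate scaling drops out, and only the holomorphic scaling by `l`
  -- remains.
  rw [(wirtinger_iterate_congr hev k).eq_of_nhds, hw, gHatCoeff_eq h0]
  simp only [map_zero, mul_zero, zero_add]
  have hq' : ContDiffAt ℂ k (fun s : ℂ => B * s ^ 2) 0 := by fun_prop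
  rw [iteratedDeriv_fun_add hq' hs, iteratedDeriv_const_mul_sq,
    iteratedDeriv_comp_mul_left k (fun s => Complex.log (THatPolar τ w s 0 / THat 0 τ w)) l 0,
    mul_zero, hl, mul_pow]
  split_ifs with hk
  · subst hk
    have hI := Complex.I_sq
    rw [hB]
    field_simp
    linear_combination (-2 * ((γ 1 0 : ℤ) : ℂ) * Real.pi * Complex.I) * hI
  · ring

/-! ### The limit as t → ∞ -/

theorem differentiableOn_iteratedDeriv {f : ℂ → ℂ} {U : Set ℂ} (hU : IsOpen U)
    (hf : DifferentiableOn ℂ f U) (k : ℕ) : DifferentiableOn ℂ (iteratedDeriv k f) U := by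
  induction k with
  | zero => simpa using hf
  | succ k ih => rw [iteratedDeriv_succ]; exact ih.deriv hU

theorem tendstoLocallyUniformlyOn_iteratedDeriv {ι : Type*} {φ : Filter ι} {F : ι → ℂ → ℂ}
    {f : ℂ → ℂ} {U : Set ℂ} (hU : IsOpen U) (h : TendstoLocallyUniformlyOn F f φ U)
    (hF : ∀ᶠ i in φ, DifferentiableOn ℂ (F i) U) (k : ℕ) :
    TendstoLocallyUniformlyOn (fun i => iteratedDeriv k (F i)) (iteratedDeriv k f) φ U := by
  induction k with
  | zero => simpa using h
  | succ k ih =>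
    simp only [iteratedDeriv_succ]
    exact ih.deriv (hF.mono fun i hi => differentiableOn_iteratedDeriv hU hi k) hU

theorem iteratedDeriv_log_div {g : ℂ → ℂ} (k : ℕ) (hg : ∀ᶠ s in 𝓝 0, DifferentiableAt ℂ g s)
    (h0 : g 0 ≠ 0) :
    iteratedDeriv (k + 1) (fun s => Complex.log (g s / g 0)) 0 = iteratedDeriv k (deriv g / g) 0 := by
  rw [iteratedDeriv_succ']
  refine Filter.EventuallyEq.iteratedDeriv_eq k ?_
  have h1 : ContinuousAt (fun s => g s / g 0) 0 :=
    (hg.self_of_nhds.continuousAt).div_const _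
  have h2 : ∀ᶠ s in 𝓝 0, g s / g 0 ∈ Complex.slitPlane :=
    h1.eventually (Complex.isOpen_slitPlane.mem_nhds (by simp [h0]))
  filter_upwards [hg, h2] with s hs hs2
  rw [((hs.hasDerivAt.div_const (g 0)).clog hs2).deriv, Pi.div_apply]
  field_simp

/-- On a small disc f is bounded away from 0, so eventually no `F i` vanishes there and F'/F
converges locally uniformly. Passing to F'/F removes the logarithm and uses up one of the k + 1
derivatives. -/
theorem tendsto_iteratedDeriv_log {ι : Type*} {φ : Filter ι} [φ.NeBot] {F : ι → ℂ → ℂ} {f : ℂ → ℂ}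
    {r : ℝ} (hr : 0 < r) (hF : ∀ i, Differentiable ℂ (F i))
    (h : TendstoUniformlyOn F f φ (Metric.ball 0 r)) (h0 : f 0 ≠ 0) (k : ℕ) :
    Tendsto (fun i => iteratedDeriv (k + 1) (fun s => Complex.log (F i s / F i 0)) 0) φ
      (𝓝 (iteratedDeriv (k + 1) (fun s => Complex.log (f s / f 0)) 0)) := by
  have hfd : DifferentiableOn ℂ f (Metric.ball 0 r) := h.tendstoLocallyUniformlyOn.differentiableOn
    (Eventually.of_forall fun i => (hF i).differentiableOn) Metric.isOpen_ball
  have hf0 : ContinuousAt f 0 :=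
    (hfd.differentiableAt (Metric.ball_mem_nhds 0 hr)).continuousAt
  have hδ : 0 < ‖f 0‖ / 2 := half_pos (norm_pos_iff.2 h0)
  obtain ⟨ρ, hρ, hfρ⟩ := Metric.continuousAt_iff.1 hf0 _ hδ
  set U : Set ℂ := Metric.ball 0 (min r ρ) with hU
  have hUo : IsOpen U := Metric.isOpen_ball
  have hUr : U ⊆ Metric.ball 0 r := Metric.ball_subset_ball (min_le_left _ _)
  have h0U : (0 : ℂ) ∈ U := Metric.mem_ball_self (lt_min hr hρ)
  have hfU (s : ℂ) (hs : s ∈ U) : ‖f 0‖ / 2 < ‖f s‖ := by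
    have h1 := hfρ (Metric.ball_subset_ball (min_le_right _ _) hs)
    rw [dist_comm, dist_eq_norm] at h1
    have := norm_sub_norm_le (f 0) (f s)
    linarith
  have hfU0 (s : ℂ) (hs : s ∈ U) : f s ≠ 0 := norm_pos_iff.1 (hδ.trans (hfU s hs))
  have hFU : ∀ᶠ i in φ, ∀ s ∈ U, F i s ≠ 0 := by
    filter_upwards [Metric.tendstoUniformlyOn_iff.1 (h.mono hUr) _ hδ] with i hi s hs hz
    have h1 := hi s hs
    rw [hz, dist_zero_right] at h1
    exact lt_asymm h1 (hfU s hs)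
  have hloc : TendstoLocallyUniformlyOn F f φ U := (h.mono hUr).tendstoLocallyUniformlyOn
  have hFd : ∀ᶠ i in φ, DifferentiableOn ℂ (F i) U :=
    Eventually.of_forall fun i => (hF i).differentiableOn
  have hfdU := hfd.mono hUr
  have hquot : TendstoLocallyUniformlyOn ((deriv ∘ F) / F) (deriv f / f) φ U :=
    (hloc.deriv hFd hUo).div₀ hloc (hfdU.deriv hUo).continuousOn hfdU.continuousOn hfU0
  have hqd : ∀ᶠ i in φ, DifferentiableOn ℂ (((deriv ∘ F) / F) i) U := by
    filter_upwards [hFU] with i hi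
    exact ((hF i).differentiableOn.deriv hUo).div (hF i).differentiableOn hi
  have hlim := (tendstoLocallyUniformlyOn_iteratedDeriv hUo hquot hqd k).tendsto_at h0U
  rw [iteratedDeriv_log_div k ?_ h0]
  · refine hlim.congr' ?_
    filter_upwards [hFU] with i hi
    exact (iteratedDeriv_log_div k (Eventually.of_forall fun s => hF i s) (hi 0 h0U)).symm
  · filter_upwards [hUo.mem_nhds h0U] with s hs
    exact hfdU.differentiableAt (hUo.mem_nhds hs)

theorem summable_thetaTerm (z : ℂ) (τ : ℍ) : Summable fun n => thetaTerm n z τ := by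
  have h := summable_abs_add_mul_exp τ.im_pos 1 (Real.pi * (τ.im + 2 * ‖z‖ ^ 2 + 2 * ‖z‖))
    (Real.pi * (‖z‖ ^ 2 + ‖z‖ + ‖z‖ ^ 3))
  refine h.of_norm_bounded fun n => ?_
  have h1 := norm_exp_mul_thetaTerm_le (n := n) (z := z) (α := 0) (w := τ) (R := ‖z‖) (s := 0)
    (le_refl τ.im) le_rfl τ.im_pos le_rfl (by simp) (by simp) (by simp)
  simp only [Complex.ofReal_zero, ne_eq, OfNat.ofNat_ne_zero, not_false_eq_true, zero_pow, zero_mul,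
    neg_zero, Complex.exp_zero, one_mul] at h1
  refine h1.trans (le_mul_of_one_le_left (Real.exp_pos _).le ?_)
  simp

/-- The sign of `n + 1/2`. -/
def halfSign (n : ℤ) : ℂ := if 0 ≤ n then 1 else -1

theorem T_eq_tsum_int (z : ℂ) (τ : ℍ) :
    T z τ = Complex.I * ∑' n : ℤ, (1 + halfSign n) * thetaTerm n z τ := by
  have h1 : Summable fun n : ℕ => thetaTerm n z τ :=
    (summable_thetaTerm z τ).comp_injective Nat.cast_injective
  have h2 : HasSum (fun n : ℤ => (1 + halfSign n) * thetaTerm n z τ)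
      (2 * ∑' n : ℕ, thetaTerm n z τ + 0) := by
    refine HasSum.of_nat_of_neg_add_one ?_ ?_
    · refine (h1.hasSum.mul_left 2).congr_fun fun n => ?_
      rw [halfSign, if_pos (Int.natCast_nonneg n)]
      ring
    · refine hasSum_zero.congr_fun fun n => ?_
      rw [halfSign, if_neg (by omega)]
      ring
  rw [h2.tsum_eq, T]
  ring

theorem THatPolar_sub_T (τ w : ℍ) (z z' : ℂ) :
    THatPolar τ w z z' - T z τ = Complex.I * ∑' n : ℤ,
      (erf (-Complex.I * Complex.sqrt (Real.pi * Complex.I * ((w : ℂ) - τ)) *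
        ((n : ℂ) + 1 / 2 + (z - z') / (2 * Complex.I * (τ.im : ℂ)))) - halfSign n) *
        thetaTerm n z τ := by
  set α := (z - z') / (2 * Complex.I * (τ.im : ℂ)) with hα
  have h1 := (summable_thetaTerm z τ).hasSum
  have h2 : HasSum (fun n : ℤ => erf (-Complex.I * Complex.sqrt (Real.pi * Complex.I *
      ((w : ℂ) - τ)) * ((n : ℂ) + 1 / 2 + α)) * thetaTerm n z τ) _ :=
    ((summable_errTerm z α τ w.im_pos).hasSum.mul_left _).congr_fun
      fun n => erf_mul_thetaTerm n z α τ w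
  have h3 : Summable fun n : ℤ => (1 + halfSign n) * thetaTerm n z τ := by
    refine Summable.of_norm_bounded ((summable_thetaTerm z τ).norm.mul_left 2) fun n => ?_
    rw [norm_mul]
    gcongr
    rw [halfSign]
    split_ifs <;> norm_num
  have h4 := (h1.add h2).sub h3.hasSum
  have h5 := h4.congr_fun (g := fun n : ℤ => (erf (-Complex.I * Complex.sqrt (Real.pi * Complex.I *
    ((w : ℂ) - τ)) * ((n : ℂ) + 1 / 2 + α)) - halfSign n) * thetaTerm n z τ) fun n => by ring
  rw [h5.tsum_eq, THatPolar, T_eq_tsum_int, jacobiTheta, psiFactor, errSum]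
  ring

/-- Here |Re x| ≥ 3/8 exceeds |Im x|, and |Im σ| ≤ Re σ, so Re(σx) does not have the sign opposite
to n + 1/2. For negative n the oddness of `erf` reduces to a point in the right half-plane. -/
theorem norm_erf_sub_halfSign_le {n : ℤ} {σ x : ℂ} (hσ : |σ.im| ≤ σ.re)
    (hx : ‖x - ((n : ℂ) + 1 / 2)‖ ≤ 1 / 8) :
    ‖erf (σ * x) - halfSign n‖ ≤ ‖Complex.exp (-(σ * x) ^ 2)‖ := by
  have hre : |x.re - ((n : ℝ) + 1 / 2)| ≤ 1 / 8 := by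
    refine le_trans ?_ ((Complex.abs_re_le_norm _).trans hx)
    simp
  have him : |x.im| ≤ 1 / 8 := by
    refine le_trans ?_ ((Complex.abs_im_le_norm _).trans hx)
    simp
  have hσ0 : 0 ≤ σ.re := (abs_nonneg _).trans hσ
  rw [abs_le] at hre him hσ
  rw [halfSign]
  split_ifs with hn
  · have hn' : (0 : ℝ) ≤ n := by exact_mod_cast hn
    rw [norm_sub_rev]
    refine norm_one_sub_erf_le ?_
    rw [Complex.mul_re]
    nlinarith
  · have hn' : (n : ℝ) ≤ -1 := by exact_mod_cast (show n ≤ -1 by omega)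
    have h := norm_one_sub_erf_le (y := -(σ * x)) (by
      rw [Complex.neg_re, Complex.mul_re]
      nlinarith)
    rwa [erf_neg, neg_sq, sub_neg_eq_add, add_comm, ← sub_neg_eq_add] at h

theorem norm_exp_neg_mul_sq_le {n : ℤ} {σ x : ℂ} {t ε : ℝ} (ht : 0 ≤ t) (hε : 0 < ε)
    (hσ : σ ^ 2 = Real.pi * (t - Complex.I * ε)) (hx : ‖x - ((n : ℂ) + 1 / 2)‖ ≤ 1 / 8) :
    ‖Complex.exp (-(σ * x) ^ 2)‖ ≤
      Real.exp (-(Real.pi / 8 * t)) * Real.exp (Real.pi * ε * (|(n : ℝ)| + 1)) := by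
  have hre : |x.re - ((n : ℝ) + 1 / 2)| ≤ 1 / 8 := by
    refine le_trans ?_ ((Complex.abs_re_le_norm _).trans hx)
    simp
  have him : |x.im| ≤ 1 / 8 := by
    refine le_trans ?_ ((Complex.abs_im_le_norm _).trans hx)
    simp
  have hpi := Real.pi_pos
  rw [Complex.norm_exp, ← Real.exp_add, Real.exp_le_exp, mul_pow, hσ]
  have h1 : (-(Real.pi * (t - Complex.I * ε) * x ^ 2)).re =
      Real.pi * (-(t * (x.re ^ 2 - x.im ^ 2)) - ε * (2 * x.re * x.im)) := by
    simp [pow_two, Complex.mul_re, Complex.mul_im]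
    ring
  rw [h1]
  -- (3/8)² - (1/8)² = 1/8, the source of the decay rate π/8. The ε-part of the exponent grows only
  -- linearly in |n| and is absorbed by the theta term.
  have h2 : 1 / 8 ≤ x.re ^ 2 - x.im ^ 2 := by
    have h3 : 3 / 8 ≤ |x.re| := by
      rw [abs_le] at hre
      rcases le_or_gt 0 n with hn | hn
      · have hn' : (0 : ℝ) ≤ n := by exact_mod_cast hn
        exact le_trans (by linarith) (le_abs_self _)
      · have hn' : (n : ℝ) ≤ -1 := by exact_mod_cast (show n ≤ -1 by omega)
        exact le_trans (by linarith) (neg_le_abs _)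
    have h4 := pow_le_pow_left₀ (by norm_num) h3 2
    have h5 := pow_le_pow_left₀ (abs_nonneg _) him 2
    rw [sq_abs] at h4 h5
    linarith
  have h6 : -(2 * x.re * x.im) ≤ |(n : ℝ)| + 1 := by
    have h7 : |x.re| ≤ |(n : ℝ)| + 5 / 8 := by
      have : x.re = (x.re - ((n : ℝ) + 1 / 2)) + n + 1 / 2 := by ring
      rw [this]
      refine (abs_add_le _ _).trans ?_
      have h8 := (abs_add_le (x.re - ((n : ℝ) + 1 / 2)) (n : ℝ))
      rw [abs_of_pos (show (0 : ℝ) < 1 / 2 by norm_num)]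
      linarith
    have h9 := neg_le_abs (x.re * x.im)
    rw [abs_mul] at h9
    nlinarith [abs_nonneg x.re, abs_nonneg x.im, abs_nonneg (n : ℝ)]
  have h10 := mul_le_mul_of_nonneg_left h2 ht
  have h11 := mul_le_mul_of_nonneg_left h6 hε.le
  nlinarith

theorem exists_norm_THatPolar_sub_T_le (τ : ℍ) {ε : ℝ} (hε : 0 < ε) :
    ∃ r S : ℝ, 0 < r ∧ ∀ (t : ℝ) (w : ℍ), 0 ≤ t → (w : ℂ) = τ + Complex.I * t + ε →
      ∀ s : ℂ, ‖s‖ ≤ r → ‖THatPolar τ w s 0 - T s τ‖ ≤ S * Real.exp (-(Real.pi / 8 * t)) := by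
  -- For |s| ≤ Im τ/4 the shift s/(2i Im τ) has modulus at most 1/8.
  set r := τ.im / 4 with hr
  have hr0 : 0 < r := div_pos τ.im_pos (by norm_num)
  set u : ℤ → ℝ := fun n => (|(n : ℝ)| + 1) * Real.exp ((Real.pi * (r ^ 2 + r + r ^ 3) +
    Real.pi * ε) + (Real.pi * (τ.im + 2 * r ^ 2 + 2 * r) + Real.pi * ε) * |(n : ℝ)| -
    Real.pi * τ.im * n ^ 2) with hu
  have hus : Summable u := summable_abs_add_mul_exp τ.im_pos 1 _ _
  refine ⟨r, ∑' n, u n, hr0, fun t w ht hw s hs => ?_⟩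
  have hwτ : (w : ℂ) - τ = Complex.I * t + ε := by rw [hw]; ring
  rw [THatPolar_sub_T τ w s 0, norm_mul, Complex.norm_I, one_mul, mul_comm (∑' n, u n), ← tsum_mul_left]
  refine tsum_of_norm_bounded (hus.mul_left _).hasSum fun n => ?_
  set X := Real.pi * Complex.I * ((w : ℂ) - τ) with hX
  set σ := -Complex.I * Complex.sqrt X with hσ
  have hσ2 : σ ^ 2 = Real.pi * (t - Complex.I * ε) := by
    rw [hσ, mul_pow, sqrt_sq, hX, hwτ]
    linear_combination ((-Real.pi * t : ℂ) + (Complex.I ^ 2 - 1) * Real.pi * t +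
      Complex.I * Real.pi * ε + Real.pi * t) * Complex.I_sq
  -- Since Im X = πε > 0, the principal root of X has nonnegative imaginary part, which equals Re σ.
  -- This fixes the sign of the limit of `erf`.
  have hσre : 0 ≤ σ.re := by
    have h1 : σ.re = (Complex.sqrt X).im := by simp [hσ]
    have h2 : X.im = Real.pi * ε := by rw [hX, hwτ]; simp
    rw [h1, Complex.sqrt, Complex.cpow_inv_two_im_eq_sqrt (by rw [h2]; positivity)]
    positivity
  -- Re σ² = πt ≥ 0 places σ in the sector |arg σ| ≤ π/4.
  have hσle : |σ.im| ≤ σ.re := by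
    have h1 := congrArg Complex.re hσ2
    have h2 : (Real.pi * (t - Complex.I * ε) : ℂ).re = Real.pi * t := by simp
    rw [h2, pow_two, Complex.mul_re] at h1
    refine abs_le_of_sq_le_sq ?_ hσre
    nlinarith [mul_nonneg Real.pi_pos.le ht]
  set x := (n : ℂ) + 1 / 2 + (s - 0) / (2 * Complex.I * (τ.im : ℂ)) with hx
  have hxn : ‖x - ((n : ℂ) + 1 / 2)‖ ≤ 1 / 8 := by
    rw [hx, add_sub_cancel_left, sub_zero, norm_div, norm_mul, norm_mul, Complex.norm_two,
      Complex.norm_I, Complex.norm_real, Real.norm_of_nonneg τ.im_pos.le,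
      div_le_iff₀ (by have := τ.im_pos; positivity)]
    rw [hr] at hs
    linarith
  have h1 := (norm_erf_sub_halfSign_le hσle hxn).trans (norm_exp_neg_mul_sq_le ht hε hσ2 hxn)
  have h2 := norm_exp_mul_thetaTerm_le (n := n) (z := s) (α := 0) (w := τ) (R := r) (s := 0)
    (le_refl τ.im) le_rfl τ.im_pos hs (by simpa using hr0.le) (by simpa using hr0.le) (by simp)
  simp only [Complex.ofReal_zero, ne_eq, OfNat.ofNat_ne_zero, not_false_eq_true, zero_pow, zero_mul,
    neg_zero, Complex.exp_zero, one_mul] at h2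
  rw [norm_mul]
  refine (mul_le_mul h1 h2 (norm_nonneg _) (by positivity)).trans ?_
  rw [mul_assoc, ← Real.exp_add]
  refine mul_le_mul_of_nonneg_left ?_ (Real.exp_pos _).le
  rw [hu]
  refine le_trans (le_of_eq ?_) (le_mul_of_one_le_left (Real.exp_pos _).le (by simp))
  congr 1
  ring

theorem differentiable_THatPolar_left (τ w : ℍ) (b : ℂ) :
    Differentiable ℂ fun s => THatPolar τ w s b := by
  have h1 := (contDiff_THatPolar τ w 1).comp (contDiff_prodMk_left (𝕜 := ℂ) (n := (1 : ℕ)) b)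
  intro s
  exact h1.contDiffAt.differentiableAt one_ne_zero

theorem tendsto_gHatCoeff {τ : ℍ} (hT : T 0 τ ≠ 0) {ε : ℝ} (hε : 0 < ε) {k : ℕ} (hk : 1 ≤ k) :
    (∀ᶠ t : ℝ in atTop, THat 0 τ
      (UpperHalfPlane.ofComplex ((τ : ℂ) + Complex.I * (t : ℂ) + (ε : ℂ))) ≠ 0) ∧
    Tendsto (fun t : ℝ => gHatCoeff k τ
      (UpperHalfPlane.ofComplex ((τ : ℂ) + Complex.I * (t : ℂ) + (ε : ℂ)))) atTop (𝓝 (g k τ)) := by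
  obtain ⟨r, S, hr, hS⟩ := exists_norm_THatPolar_sub_T_le τ hε
  set w : ℝ → ℍ := fun t => UpperHalfPlane.ofComplex ((τ : ℂ) + Complex.I * (t : ℂ) + (ε : ℂ))
    with hw
  -- `UpperHalfPlane.ofComplex` returns its argument only when the imaginary part is positive; t ≥ 0
  -- suffices for that.
  have hwt (t : ℝ) (ht : 0 ≤ t) : (w t : ℂ) = τ + Complex.I * t + ε := by
    have h1 : 0 < ((τ : ℂ) + Complex.I * (t : ℂ) + (ε : ℂ)).im := by
      have := τ.im_pos
      simp
      linarith
    rw [hw]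
    simp only [UpperHalfPlane.ofComplex_apply_of_im_pos h1]
  have hlim : Tendsto (fun t : ℝ => S * Real.exp (-(Real.pi / 8 * t))) atTop (𝓝 0) := by
    have h1 : Tendsto (fun t : ℝ => -(Real.pi / 8 * t)) atTop atBot :=
      tendsto_neg_atTop_atBot.comp (tendsto_id.const_mul_atTop (by positivity))
    simpa using (Real.tendsto_exp_atBot.comp h1).const_mul S
  have hunif : TendstoUniformlyOn (fun t s => THatPolar τ (w t) s 0) (fun s => T s τ) atTop
      (Metric.ball 0 r) := by
    rw [Metric.tendstoUniformlyOn_iff]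
    intro δ hδ
    filter_upwards [hlim.eventually (gt_mem_nhds hδ), eventually_ge_atTop 0] with t ht ht0 s hs
    rw [dist_comm, dist_eq_norm]
    exact (hS t (w t) ht0 (hwt t ht0) s (mem_ball_zero_iff.1 hs).le).trans_lt ht
  have hne : ∀ᶠ t in atTop, THat 0 τ (w t) ≠ 0 := by
    have h1 := (hunif.tendsto_at (Metric.mem_ball_self hr)).eventually_ne hT
    simpa only [THatPolar_zero] using h1
  refine ⟨hne, ?_⟩
  obtain ⟨k, rfl⟩ := Nat.exists_eq_add_of_le' hk
  have h := ((tendsto_iteratedDeriv_log hr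
    (fun t => differentiable_THatPolar_left τ (w t) 0) hunif hT k).neg).div_const
    ((2 * Real.pi * Complex.I) ^ (k + 1))
  refine Tendsto.congr' ?_ h
  filter_upwards [hne] with t ht
  rw [gHatCoeff_eq ht]
  simp only [THatPolar_zero]

end PartialTheta

end

/-! ### Extension across the zeros of T̂(0;τ,w) and conclusion -/

open PartialTheta in
theorem theorem1p1 :
    ∃ gHat : ℕ → ℍ → ℍ → ℂ,
      -- the functions are the Taylor coefficients coming from the completed partial theta function
      (∀ k : ℕ, 1 ≤ k → ∀ τ w : ℍ, PartialTheta.THat 0 τ w ≠ 0 →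
        gHat k τ w = PartialTheta.gHatCoeff k τ w) ∧
      -- modular transformation
      (∀ k : ℕ, 1 ≤ k → ∀ (γ : SL(2, ℤ)) (τ w : ℍ), τ ≠ w →
        gHat k (γ • τ) (γ • w) =
          PartialTheta.chi γ τ w ^ k * PartialTheta.cocycle γ τ ^ k * gHat k τ w +
            if k = 2 then
              Complex.I * ((γ 1 0 : ℤ) : ℂ) / (2 * Real.pi) * PartialTheta.cocycle γ τ
            else 0) ∧
      -- limit
      (∀ k : ℕ, 1 ≤ k → ∀ τ : ℍ, PartialTheta.T 0 τ ≠ 0 → ∀ ε : ℝ, 0 < ε →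
        Tendsto
          (fun t : ℝ => gHat k τ
            (UpperHalfPlane.ofComplex ((τ : ℂ) + Complex.I * (t : ℂ) + (ε : ℂ))))
          atTop (𝓝 (PartialTheta.g k τ))) := by
  classical
  -- The zero set of T̂(0;τ,w) off the diagonal is SL₂(ℤ)-invariant, so values there may be any
  -- solution of the same law. For k ≠ 2 zero works. For k = 2, 1/(γτ-γw) = (cτ+d)²/(τ-w) - c(cτ+d),
  -- and the constant -i/(2π) turns the last term into the required anomaly, with χ² = 1.
  refine ⟨fun k τ w => if THat 0 τ w ≠ 0 then gHatCoeff k τ w else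
    if k = 2 then -Complex.I / (2 * Real.pi) / ((τ : ℂ) - w) else 0,
    fun k _ τ w h => if_pos h, fun k _ γ τ w h => ?_, fun k hk τ hT ε hε => ?_⟩
  · by_cases h0 : THat 0 τ w ≠ 0
    · simp only [if_pos h0, if_pos ((THat_zero_smul_ne_zero_iff γ h).2 h0)]
      exact gHatCoeff_smul k γ h h0
    · simp only [if_neg h0, if_neg (mt (THat_zero_smul_ne_zero_iff γ h).1 h0)]
      split_ifs with hk
      · subst hk
        have h1 := cocycle_ne_zero γ τ
        have h2 := cocycle_ne_zero γ w
        have h3 : (τ : ℂ) - w ≠ 0 := sub_ne_zero.2 fun h4 => h (UpperHalfPlane.ext h4)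
        have h5 : cocycle γ w = cocycle γ τ - ((γ 1 0 : ℤ) : ℂ) * ((τ : ℂ) - w) := by
          rw [cocycle, cocycle]; ring
        have hpi : (Real.pi : ℂ) ≠ 0 := by exact_mod_cast Real.pi_ne_zero
        rw [chi_sq γ h, smul_sub_smul γ w τ]
        field_simp
        rw [h5]
        ring
      · ring
  · obtain ⟨h1, h2⟩ := tendsto_gHatCoeff hT hε hk
    refine h2.congr' ?_
    filter_upwards [h1] with t ht
    exact (if_pos ht).symm
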